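/- Let $q$ be an odd prime power, let $\mathbb{F}_q$ be the field with $q$ elements, and let $\chi$ be a nontrivial additive character of $\mathbb{F}_q$ with values in $\mathbb{C}$. Let $O(2)=\{g\in \mathrm{Mat}_2(\mathbb{F}_q): g^Tg=I\}$ and $SO(2)=\{g\in O(2):\det g=1\}$. The $O(2)$-Cayley digraph has vertex set $\mathrm{Mat}_2(\mathbb{F}_q)$ and an edge from $X$ to $Y$ if and only if $Y-X\in O(2)$. For $A\in \mathrm{Mat}_2(\mathbb{F}_q)$ put $\chi_A(X)=\chi(\mathrm{Tr}(AX))$ and $$\lambda_A=\sum_{g\in O(2)}\chi_A(g).$$ Let $A=\begin{bmatrix} a&b\\ c&d\end{bmatrix}\in GL_2(\mathbb{F}_q)$, and let $L_1=a^2+c^2$, $L_2=b^2+d^2$ and $\mu=ab+cd$ be the lengths of its columns and their dot product. Then: 1. $L_1L_2-\mu^2$ is a nonzero square in $\mathbb{F}_q$. 2. $\lambda_A$ is an eigenvalue of the adjacency matrix of the $O(2)$-Cayley digraph, with eigenfunction $\chi_A$. 3. For fixed $\chi$, $\lambda_A$ depends only on $(L_1,L_2,\mu)$, so that we may write $\lambda_A=\lambda_{L_1,L_2,\mu}$;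 and $\lambda_{L_1,L_2,\mu}=\lambda_{L_2,L_1,\mu}$. 4. $|\lambda_{L_1,L_2,\mu}|\le 4\sqrt q$, except possibly when $L_1=L_2\ne 0$ and $\mu=0$. 5. If $L_1=L_2=L\neq 0$ and $\mu=0$, then $\lambda_{L,L,0}=|SO(2)|+E$ for some $E\in\mathbb{C}$ with $|E|\le 2\sqrt q$. Here $|SO(2)|=q-1$ if $q\equiv 1 \pmod 4$ and $|SO(2)|=q+1$ if $q\equiv 3\pmod 4$. -/

import Mathlib

/-- The Cayley digraph of a set `G` of square matrices: the vertices are all `n × n` matrices, and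
there is an edge from `X` to `Y` exactly when `Y - X ∈ G`. -/
def matCayleyDigraph {F : Type*} [Field F] {n : ℕ} (G : Set (Matrix (Fin n) (Fin n) F)) :
    Digraph (Matrix (Fin n) (Fin n) F) where
  Adj X Y := Y - X ∈ G

open Classical in
/-- The adjacency matrix of a digraph, with complex entries: the `(X, Y)` entry is `1` if there is
an edge from `X` to `Y`, and `0` otherwise. -/
noncomputable def digraphAdjMatrix {V : Type*} (D : Digraph V) : Matrix V V ℂ :=
  Matrix.of fun X Y => if D.Adj X Y then 1 else 0

/-- The function `X ↦ χ (Tr (A X))` on matrices. -/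
def matChar {F : Type*} [Field F] {n : ℕ} (χ : AddChar F ℂ) (A : Matrix (Fin n) (Fin n) F) :
    Matrix (Fin n) (Fin n) F → ℂ :=
  fun X => χ (A * X).trace

open Classical in
/-- The number `λ_A = ∑_{g ∈ O(2)} χ (Tr (A g))`. -/
noncomputable def orthoEigenvalue {F : Type*} [Field F] [Fintype F] (χ : AddChar F ℂ)
    (A : Matrix (Fin 2) (Fin 2) F) : ℂ :=
  ∑ g : Matrix (Fin 2) (Fin 2) F with g ∈ Matrix.orthogonalGroup (Fin 2) F, matChar χ A g

/-- The dot product of columns `i` and `j` of `A`; for `i = j` this is the length of the column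
(the sum of the squares of its entries). -/
def colDot {F : Type*} [Field F] (A : Matrix (Fin 2) (Fin 2) F) (i j : Fin 2) : F :=
  A.col i ⬝ᵥ A.col j

/-!
The eigenvalue `λ_A` splits into the sum over rotations and the sum over reflections
(`orthoEigenvalue_eq_circleSum_add`). Each is a sum `∑ χ(u x + v y)` over the circle
`x² + y² = 1`, with frequency `(a + d, b - c)` for the rotations and `(a - d, b + c)` for the
reflections. At frequency zero such a sum is `|SO(2)|`, and a frequency vanishes exactly when the
columns of `A` are orthogonal of equal nonzero length. Every other circle sum is at most `2 √q`
(`norm_circleSum_le`). Matrices with the same Gram matrix differ by an orthogonal factor, and so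
does `A` from `A` with its columns exchanged; such factors only permute the terms of `λ_A`, whence
the dependence on `(L₁, L₂, μ)` alone and the symmetry.

A circle sum at a nonzero isotropic frequency equals `-1`. At a frequency with
`m = u² + v² ≠ 0` it becomes, after a change of coordinates, `±S` with `S = ∑ χ(z) η(z² - m)`, `η`
the quadratic character, and the bound is Weil's (`norm_sum_addChar_mul_quadraticChar_le`). Its
proof has three ingredients.

* The L-function. The completely multiplicative weight `conicWeight` on monic polynomials takes the
  value `χ(α) η(α² - m)` at `X - α`. Its sums over monic polynomials of degree `0, 1, 2` are
  `1, S, q`, and they vanish from degree `3` on. Unique factorization gives Newton's identities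
  between these sums and the sums over prime powers (`natCast_mul_sum_monicsOfDegree`). The latter
  are the sums `S_n = ∑ χ(Tr z) η(z² - m)` over the extensions of degree `n`, so that
  `S_n = -(xⁿ + yⁿ)`, where `x` and `y` are the inverse zeros of `1 + S T + q T²`
  (`exists_sum_addChar_trace_eq_powerSum`).
* Stepanov's method. Adding up `S_n` over all additive characters of the base field counts points
  on the curve `y² = (w ^ q - w)² - m` over the extension. A polynomial that vanishes to high order
  at all `w` where the right side is a nonsquare bounds this sum from below by `-C q ^ (n / 2)`,
  for `n` even and large (`neg_le_sum_quadraticChar_pow_card_sub_self`).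
* Power sums. Hence the power sums of all the `x² / q` and `y² / q` together have real part
  bounded above, which forces `|x|, |y| ≤ √q` (`norm_le_one_of_re_powerSum_le`), and
  `|S| = |x + y| ≤ 2 √q`.
-/

/-! ### Power sums of complex numbers -/

open Filter Topology in
/-- Simultaneous recurrence of finitely many points of the unit circle: some arbitrarily large
power brings all of them close to `1`. -/
theorem exists_large_pow_near_one {ι : Type*} [Finite ι] (u : ι → ℂ) (hu : ∀ i, ‖u i‖ = 1)
    (N : ℕ) : ∃ n, N ≤ n ∧ ∀ i, ‖u i ^ n - 1‖ < 1 / 2 := by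
  cases nonempty_fintype ι
  have hmem : ∀ n : ℕ, (u ^ n) ∈ Metric.closedBall (0 : ι → ℂ) 1 := by
    intro n
    rw [mem_closedBall_zero_iff, pi_norm_le_iff_of_nonneg zero_le_one]
    intro i
    simp [hu i]
  obtain ⟨a, -, φ, hφ, hlim⟩ := (isCompact_closedBall (0 : ι → ℂ) 1).tendsto_subseq hmem
  obtain ⟨M, hM⟩ := (Metric.cauchySeq_iff.1 hlim.cauchySeq) (1 / 2) (by norm_num)
  have hle : φ M + N ≤ φ (φ M + N + M) := by
    have := hφ.le_apply (x := φ M + N + M)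
    omega
  -- The exponents along the convergent subsequence grow at least linearly, so this gap is at
  -- least `N`.
  refine ⟨φ (φ M + N + M) - φ M, by omega, fun i => ?_⟩
  have h1 := hM (φ M + N + M) (by omega) M le_rfl
  have h2 := (dist_le_pi_dist (u ^ φ (φ M + N + M)) (u ^ φ M) i).trans_lt h1
  rw [dist_eq_norm] at h2
  have h3 : (u ^ φ (φ M + N + M)) i - (u ^ φ M) i
      = u i ^ φ M * (u i ^ (φ (φ M + N + M) - φ M) - 1) := by
    rw [mul_sub, ← pow_add, Nat.add_sub_cancel' (by omega)]
    simp
  rwa [h3, norm_mul, norm_pow, hu i, one_pow, one_mul] at h2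

/-- If the real parts of the power sums of finitely many complex numbers stay bounded above, the
numbers lie in the closed unit disc: along exponents at which all the powers are nearly positive
reals, no cancellation takes place. -/
theorem norm_le_one_of_re_powerSum_le {ι : Type*} [Fintype ι] (z : ι → ℂ) (C : ℝ) (N : ℕ)
    (h : ∀ k, N ≤ k → (∑ i, z i ^ k).re ≤ C) (i : ι) : ‖z i‖ ≤ 1 := by
  by_contra! hi
  obtain ⟨K, hK⟩ := pow_unbounded_of_one_lt (2 * C) hi
  set u : ι → ℂ := fun j => if z j = 0 then 1 else z j / ‖z j‖ with hu
  have hu1 : ∀ j, ‖u j‖ = 1 := by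
    intro j
    by_cases hj : z j = 0
    · simp [hu, hj]
    · simp [hu, hj]
  have hz : ∀ j, z j = ‖z j‖ * u j := by
    intro j
    by_cases hj : z j = 0
    · simp [hj]
    · have : (‖z j‖ : ℂ) ≠ 0 := by simpa using hj
      simp only [hu, hj, if_false]
      field_simp
  obtain ⟨n, hn, hn1⟩ := exists_large_pow_near_one u hu1 (max N K)
  have hre : ∀ j, ‖z j‖ ^ n / 2 ≤ (z j ^ n).re := by
    intro j
    have h1 : (z j ^ n).re = ‖z j‖ ^ n * (u j ^ n).re := by
      conv_lhs => rw [hz j, mul_pow, ← Complex.ofReal_pow, Complex.re_ofReal_mul]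
    have h2 : 1 / 2 ≤ (u j ^ n).re := by
      have h3 := (abs_le.1 (Complex.abs_re_le_norm (u j ^ n - 1))).1
      have h4 := hn1 j
      rw [Complex.sub_re, Complex.one_re] at h3
      linarith
    rw [h1, div_eq_mul_one_div]
    gcongr
  have h5 : ‖z i‖ ^ n / 2 ≤ C := by
    calc ‖z i‖ ^ n / 2 ≤ ∑ j, ‖z j‖ ^ n / 2 :=
          Finset.single_le_sum (f := fun j => ‖z j‖ ^ n / 2) (fun j _ => by positivity)
            (Finset.mem_univ i)
      _ ≤ ∑ j, (z j ^ n).re := Finset.sum_le_sum fun j _ => hre j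
      _ = (∑ j, z j ^ n).re := by rw [Complex.re_sum]
      _ ≤ C := h n (le_trans (le_max_left _ _) hn)
  have h6 : ‖z i‖ ^ K ≤ ‖z i‖ ^ n := pow_le_pow_right₀ hi.le (le_trans (le_max_right _ _) hn)
  linarith

/-! ### Stepanov's method for `y² = f(w)` -/

open Polynomial in
/-- Up to the factor `f ^ n`, the Hasse derivatives of `f ^ n` have numerators whose degrees do not
depend on `n`. -/
theorem exists_hasseDeriv_pow_mul {K : Type*} [Field K] (f : K[X]) (n k : ℕ) :
    ∃ v : K[X], hasseDeriv k (f ^ n) * f ^ k = f ^ n * v ∧ v.natDegree ≤ k * f.natDegree := by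
  induction n generalizing k with
  | zero =>
    rcases Nat.eq_zero_or_pos k with rfl | hk
    · exact ⟨1, by simp, by simp⟩
    · exact ⟨0, by simp [hasseDeriv_apply_one k hk], by simp⟩
  | succ n ih =>
    choose v hv hdeg using ih
    refine ⟨v k + ∑ ij ∈ Finset.HasAntidiagonal.antidiagonal k, if ij.1 = 0 then 0 else
      hasseDeriv ij.1 f * f ^ (ij.1 - 1) * v ij.2, ?_, ?_⟩
    · have h0 : ∀ ij ∈ Finset.HasAntidiagonal.antidiagonal k,
          hasseDeriv ij.1 f * hasseDeriv ij.2 (f ^ n) * f ^ k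
          = (if ij.1 = 0 then f ^ (n + 1) * v ij.2 else 0) +
            f ^ (n + 1) * (if ij.1 = 0 then 0 else
              hasseDeriv ij.1 f * f ^ (ij.1 - 1) * v ij.2) := by
        rintro ⟨i, j⟩ hij
        rw [Finset.HasAntidiagonal.mem_antidiagonal] at hij
        dsimp only at hij ⊢
        subst hij
        rcases Nat.eq_zero_or_pos i with rfl | hi
        · simp only [hasseDeriv_zero', if_true, zero_add, mul_zero, add_zero]
          linear_combination f * hv j
        · obtain ⟨i, rfl⟩ := Nat.exists_eq_succ_of_ne_zero hi.ne'
          simp only [Nat.succ_ne_zero, if_false, Nat.succ_eq_add_one, Nat.add_sub_cancel]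
          linear_combination hasseDeriv (i + 1) f * f ^ (i + 1) * hv j
      rw [pow_succ', hasseDeriv_mul, Finset.sum_mul, Finset.sum_congr rfl h0,
        Finset.sum_add_distrib, ← Finset.mul_sum, mul_add, ← pow_succ']
      congr 1
      rw [Finset.Nat.sum_antidiagonal_eq_sum_range_succ_mk, Finset.sum_range_succ']
      simp
    · refine (natDegree_add_le_of_degree_le (hdeg k) ?_)
      refine natDegree_sum_le_of_forall_le _ _ ?_
      rintro ⟨i, j⟩ hij
      rw [Finset.HasAntidiagonal.mem_antidiagonal] at hij
      dsimp only at hij ⊢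
      subst hij
      rcases Nat.eq_zero_or_pos i with rfl | hi
      · simp
      · obtain ⟨i, rfl⟩ := Nat.exists_eq_succ_of_ne_zero hi.ne'
        simp only [Nat.succ_ne_zero, if_false, Nat.succ_eq_add_one, Nat.add_sub_cancel]
        refine natDegree_mul_le.trans ?_
        have h1 : (hasseDeriv (i + 1) f * f ^ i).natDegree ≤ (i + 1) * f.natDegree := by
          refine natDegree_mul_le.trans ?_
          have h2 := natDegree_hasseDeriv_le f (i + 1)
          have h3 : (f ^ i).natDegree ≤ i * f.natDegree := natDegree_pow_le
          rw [add_mul, one_mul]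
          omega
        have := hdeg j
        rw [add_mul]
        omega

open Polynomial in
/-- Over a field with `Q` elements, `X ^ (j * Q)` behaves like the constant `x ^ j` at the point
`x`, up to order `Q`. -/
theorem eval_hasseDeriv_mul_X_pow_card {K : Type*} [Field K] [Fintype K] (u : K[X]) (x : K)
    (j k : ℕ) (hk : k < Fintype.card K) :
    (hasseDeriv k (u * X ^ (j * Fintype.card K))).eval x = x ^ j * (hasseDeriv k u).eval x := by
  have h1 : (X + C x : K[X]) ^ Fintype.card K = X ^ Fintype.card K + C x := by
    rw [← FiniteField.expand_card]
    simp
  have h2 : (X : K[X]) ^ Fintype.card K ∣ (X ^ Fintype.card K + C x) ^ j - C x ^ j := by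
    have := sub_dvd_pow_sub_pow ((X : K[X]) ^ Fintype.card K + C x) (C x) j
    rwa [add_sub_cancel_right] at this
  obtain ⟨g, hg⟩ := h2
  rw [← taylor_coeff, ← taylor_coeff, taylor_mul, taylor_X_pow, mul_comm j, pow_mul, h1,
    sub_eq_iff_eq_add.1 hg, mul_add, coeff_add, ← C_pow, coeff_mul_C]
  have h3 : (taylor x u * (X ^ Fintype.card K * g)).coeff k = 0 :=
    X_pow_dvd_iff.1 (Dvd.intro_left (taylor x u * g) (by ring)) k hk
  rw [h3, zero_add, mul_comm]

open Polynomial in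
/-- A nonconstant squarefree polynomial is not a constant times the square of a rational
function. -/
theorem eq_zero_of_sq_mul_squarefree_eq {K : Type*} [Field K] {f : K[X]} (hf : Squarefree f)
    (hd : 0 < f.natDegree) {c : K} (hc : c ≠ 0) {r t : K[X]} (h : r ^ 2 * f = C c * t ^ 2) :
    r = 0 ∧ t = 0 := by
  have hcu : IsUnit (C c : K[X]) := isUnit_C.2 hc.isUnit
  have hr : r = 0 := by
    by_contra hr
    have h1 : r ^ 2 ∣ t ^ 2 := (hcu.dvd_mul_left).1 ⟨f, h.symm⟩
    obtain ⟨w, rfl⟩ := (UniqueFactorizationMonoid.pow_dvd_pow_iff_dvd two_ne_zero).1 h1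
    have h2 : f = C c * w ^ 2 := mul_left_cancel₀ (pow_ne_zero 2 hr) (by rw [h]; ring)
    have h3 : IsUnit w := hf w ⟨C c, by rw [h2]; ring⟩
    have h4 : IsUnit f := by
      rw [h2]
      exact hcu.mul (h3.pow 2)
    exact hd.ne' (natDegree_eq_zero_of_isUnit h4)
  refine ⟨hr, ?_⟩
  rw [hr] at h
  have h5 : C c * t ^ 2 = 0 := by rw [← h]; simp
  simpa [hc] using h5

open Polynomial in
/-- The auxiliary polynomial of Stepanov's method is nonzero unless all its coefficients vanish.
Modulo `X ^ Q` the square of the relation reads `r₀² f = f(0) t₀²`, because `f ^ Q` is `f(0)`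
there. -/
theorem eq_zero_of_sum_add_mul_pow_eq_zero {K : Type*} [Field K] [Fintype K] {f : K[X]}
    (hf : Squarefree f) (hd : 0 < f.natDegree) (h0 : f.eval 0 ≠ 0) {M N : ℕ}
    (hM : 2 * M + 1 = Fintype.card K) (hN : 2 * N + f.natDegree ≤ Fintype.card K + 1)
    (J : ℕ) (r t : ℕ → K[X]) (hr : ∀ j, (r j).degree < N) (ht : ∀ j, (t j).degree < N)
    (h : ∑ j ∈ Finset.range J, (r j + t j * f ^ M) * X ^ (j * Fintype.card K) = 0) :
    ∀ j < J, r j = 0 ∧ t j = 0 := by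
  induction J generalizing r t with
  | zero => simp
  | succ J ih =>
    set Q := Fintype.card K with hQ
    have hsum : ∀ u : ℕ → K[X], ∑ j ∈ Finset.range (J + 1), u j * X ^ (j * Q)
        = u 0 + X ^ Q * ∑ j ∈ Finset.range J, u (j + 1) * X ^ (j * Q) := by
      intro u
      rw [Finset.sum_range_succ', Finset.mul_sum, add_comm]
      congr 1
      · simp
      · exact Finset.sum_congr rfl fun j _ => by ring
    have h00 : r 0 = 0 ∧ t 0 = 0 := by
      set R := ∑ j ∈ Finset.range J, r (j + 1) * X ^ (j * Q)
      set T := ∑ j ∈ Finset.range J, t (j + 1) * X ^ (j * Q)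
      have h1 : (r 0 + X ^ Q * R) + (t 0 + X ^ Q * T) * f ^ M = 0 := by
        rw [← hsum r, ← hsum t, Finset.sum_mul, ← Finset.sum_add_distrib, ← h]
        exact Finset.sum_congr rfl fun j _ => by ring
      have h2 : (r 0 + X ^ Q * R) ^ 2 * f = f ^ Q * (t 0 + X ^ Q * T) ^ 2 := by
        have h21 : f ^ Q = (f ^ M) ^ 2 * f := by rw [← hM]; ring
        rw [h21]
        linear_combination ((r 0 + X ^ Q * R) - (t 0 + X ^ Q * T) * f ^ M) * f * h1
      have hQ0 : 0 < Q := Fintype.card_pos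
      obtain ⟨g, hg⟩ : X ^ Q ∣ f ^ Q - C (f.eval 0) := by
        rw [X_pow_dvd_iff]
        intro d hdQ
        rw [← FiniteField.expand_card, coeff_sub, coeff_expand hQ0, coeff_C]
        rcases Nat.eq_zero_or_pos d with rfl | hd0
        · simp [coeff_zero_eq_eval_zero]
        · rw [if_neg (Nat.not_dvd_of_pos_of_lt hd0 hdQ), if_neg hd0.ne', sub_zero]
      have h3 : X ^ Q ∣ r 0 ^ 2 * f - C (f.eval 0) * t 0 ^ 2 :=
        ⟨g * (t 0 + X ^ Q * T) ^ 2 + C (f.eval 0) * (2 * t 0 * T + X ^ Q * T ^ 2)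
          - (2 * r 0 * R + X ^ Q * R ^ 2) * f, by
          linear_combination h2 + (t 0 + X ^ Q * T) ^ 2 * hg⟩
      have h4 : r 0 ^ 2 * f - C (f.eval 0) * t 0 ^ 2 = 0 := by
        by_contra hne
        have h5 := natDegree_le_of_dvd h3 hne
        rw [natDegree_X_pow] at h5
        have hN0 : ∀ p : K[X], p.degree < N → p ≠ 0 → p.natDegree + 1 ≤ N := fun p hp hp0 =>
          (natDegree_lt_iff_degree_lt hp0).2 hp
        have h6 : (r 0 ^ 2 * f).natDegree < Q := by
          by_cases hr0 : r 0 = 0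
          · simpa [hr0] using hQ0
          · have h61 := hN0 _ (hr 0) hr0
            have h62 : (r 0 ^ 2 * f).natDegree ≤ 2 * (r 0).natDegree + f.natDegree :=
              natDegree_mul_le.trans (by gcongr; exact natDegree_pow_le)
            omega
        have h7 : (C (f.eval 0) * t 0 ^ 2).natDegree < Q := by
          by_cases ht0 : t 0 = 0
          · simpa [ht0] using hQ0
          · have h71 := hN0 _ (ht 0) ht0
            have h72 : (C (f.eval 0) * t 0 ^ 2).natDegree ≤ 2 * (t 0).natDegree :=
              (natDegree_C_mul_le _ _).trans natDegree_pow_le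
            omega
        have h8 := natDegree_sub_le (r 0 ^ 2 * f) (C (f.eval 0) * t 0 ^ 2)
        have := max_lt h6 h7
        omega
      exact eq_zero_of_sq_mul_squarefree_eq hf hd h0 (sub_eq_zero.1 h4)
    have h9 : ∑ j ∈ Finset.range J, (r (j + 1) + t (j + 1) * f ^ M) * X ^ (j * Q) = 0 := by
      have := hsum fun j => r j + t j * f ^ M
      rw [h] at this
      simp only [h00.1, h00.2, zero_mul, zero_add] at this
      exact (mul_eq_zero.1 this.symm).resolve_left (pow_ne_zero _ X_ne_zero)
    intro j hj
    cases j with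
    | zero => exact h00
    | succ j =>
      exact ih (fun j => r (j + 1)) (fun j => t (j + 1)) (fun j => hr _) (fun j => ht _) h9 j
        (by omega)

open Polynomial in
/-- The `k`-th vanishing condition on the coefficients of the auxiliary polynomial, before
summation over the exponents `j`: for a solution `x` of `f(x) ^ M = ε`, the value at `x` of the
`k`-th Hasse derivative of `(r + t * f ^ M) * X ^ (j * Q)`, times `f(x) ^ k`, is the value at `x`
of this polynomial. The polynomials `v b` are the numerators of the Hasse derivatives of
`f ^ M`. -/
noncomputable def stepanovCondition {K : Type*} [Field K] (f : K[X]) (ε : K) (v : ℕ → K[X])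
    (k j : ℕ) : K[X] × K[X] →ₗ[K] K[X] :=
  LinearMap.mulLeft K (X ^ j * f ^ k) ∘ₗ hasseDeriv k ∘ₗ LinearMap.fst K K[X] K[X] +
    ∑ ab ∈ Finset.HasAntidiagonal.antidiagonal k,
      LinearMap.mulLeft K (C ε * X ^ j * f ^ ab.1 * v ab.2) ∘ₗ hasseDeriv ab.1 ∘ₗ
        LinearMap.snd K K[X] K[X]

open Polynomial in
theorem stepanovCondition_apply {K : Type*} [Field K] (f : K[X]) (ε : K) (v : ℕ → K[X])
    (k j : ℕ) (r t : K[X]) :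
    stepanovCondition f ε v k j (r, t) = X ^ j * f ^ k * hasseDeriv k r +
      ∑ ab ∈ Finset.HasAntidiagonal.antidiagonal k,
        C ε * X ^ j * f ^ ab.1 * v ab.2 * hasseDeriv ab.1 t := by
  simp [stepanovCondition, mul_assoc]

open Polynomial in
theorem eval_stepanovCondition {K : Type*} [Field K] [Fintype K] {f : K[X]} {ε : K}
    {v : ℕ → K[X]} {M : ℕ}
    (hv : ∀ k, hasseDeriv k (f ^ M) * f ^ k = f ^ M * v k)
    {k : ℕ} (hk : k < Fintype.card K) (j : ℕ) (r t : K[X]) {x : K} (hx : f.eval x ^ M = ε) :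
    (stepanovCondition f ε v k j (r, t)).eval x =
      f.eval x ^ k *
        (hasseDeriv k ((r + t * f ^ M) * X ^ (j * Fintype.card K))).eval x := by
  rw [stepanovCondition_apply, eval_hasseDeriv_mul_X_pow_card _ _ _ _ hk, map_add, hasseDeriv_mul]
  simp only [eval_add, eval_mul, eval_pow, eval_X, eval_finsetSum, eval_C, mul_add,
    Finset.mul_sum]
  congr 1
  · ring
  · refine Finset.sum_congr rfl ?_
    rintro ⟨a, b⟩ hab
    rw [Finset.HasAntidiagonal.mem_antidiagonal] at hab
    dsimp only at hab ⊢
    subst hab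
    have h := congrArg (eval x) (hv b)
    simp only [eval_mul, eval_pow] at h
    rw [hx] at h
    rw [pow_add]
    linear_combination (-x ^ j * eval x f ^ a * eval x (hasseDeriv a t)) * h

open Polynomial in
theorem natDegree_stepanovCondition_lt {K : Type*} [Field K] {f : K[X]} (ε : K)
    {v : ℕ → K[X]} (hv : ∀ k, (v k).natDegree ≤ k * f.natDegree) {N J ℓ k j : ℕ} (hN : 0 < N)
    (hj : j < J) (hk : k < ℓ) {r t : K[X]} (hr : r.degree < N) (ht : t.degree < N) :
    (stepanovCondition f ε v k j (r, t)).natDegree < N + J + ℓ * f.natDegree := by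
  have hkl : k * f.natDegree ≤ ℓ * f.natDegree := Nat.mul_le_mul_right _ hk.le
  suffices h : (stepanovCondition f ε v k j (r, t)).natDegree ≤ j + k * f.natDegree + (N - 1) by
    omega
  have hder : ∀ (a : ℕ) {p : K[X]}, p.degree < N → (hasseDeriv a p).natDegree ≤ N - 1 := by
    intro a p hp
    have h1 : p.natDegree ≤ N - 1 := by
      by_cases hp0 : p = 0
      · simp [hp0]
      · have := (natDegree_lt_iff_degree_lt hp0).2 hp
        omega
    have := natDegree_hasseDeriv_le p a
    omega
  rw [stepanovCondition_apply]
  refine natDegree_add_le_of_degree_le ?_ (natDegree_sum_le_of_forall_le _ _ ?_)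
  · refine natDegree_mul_le_of_le (natDegree_mul_le_of_le ?_ natDegree_pow_le) (hder k hr)
    rw [natDegree_X_pow]
  · rintro ⟨a, b⟩ hab
    rw [Finset.HasAntidiagonal.mem_antidiagonal] at hab
    dsimp only at hab ⊢
    subst hab
    have h1 : (C ε * X ^ j * f ^ a * v b).natDegree ≤ j + a * f.natDegree + b * f.natDegree :=
      natDegree_mul_le_of_le (natDegree_mul_le_of_le (natDegree_C_mul_X_pow_le _ _)
        natDegree_pow_le) (hv b)
    refine (natDegree_mul_le_of_le h1 (hder a ht)).trans (le_of_eq (by ring))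

open Polynomial in
/-- With more coefficients than linear conditions, there is a nonzero choice of coefficients
for the auxiliary polynomial that satisfies all the vanishing conditions. -/
theorem exists_stepanov_coefficients {K : Type*} [Field K] (f : K[X]) (ε : K)
    (v : ℕ → K[X]) (hv : ∀ k, (v k).natDegree ≤ k * f.natDegree) {N J ℓ : ℕ} (hN : 0 < N)
    (hcount : ℓ * (N + J + ℓ * f.natDegree) < J * (N + N)) :
    ∃ r t : ℕ → K[X], (∀ j, (r j).degree < N) ∧ (∀ j, (t j).degree < N) ∧
      (∃ j < J, ¬ (r j = 0 ∧ t j = 0)) ∧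
      ∀ k < ℓ, ∑ j ∈ Finset.range J, stepanovCondition f ε v k j (r j, t j) = 0 := by
  classical
  set D := N + J + ℓ * f.natDegree with hD
  let ev : (j : Fin J) → ((Fin J → degreeLT K N × degreeLT K N) →ₗ[K] K[X] × K[X]) := fun j =>
    ((degreeLT K N).subtype.prodMap (degreeLT K N).subtype) ∘ₗ LinearMap.proj j
  let Φ : (Fin J → degreeLT K N × degreeLT K N) →ₗ[K] (Fin ℓ → Fin D → K) :=
    LinearMap.pi fun k => LinearMap.pi fun i =>
      lcoeff K i ∘ₗ ∑ j : Fin J, stepanovCondition f ε v k j ∘ₗ ev j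
  have : FiniteDimensional K (degreeLT K N) := (degreeLTEquiv K N).symm.finiteDimensional
  have hrank : Module.finrank K (degreeLT K N) = N := by
    rw [(degreeLTEquiv K N).finrank_eq, Module.finrank_fin_fun]
  have hker : LinearMap.ker Φ ≠ ⊥ := by
    apply LinearMap.ker_ne_bot_of_finrank_lt
    simpa [Module.finrank_pi_fintype, Module.finrank_prod, hrank] using hcount
  obtain ⟨c, hc, hc0⟩ := (Submodule.ne_bot_iff _).1 hker
  refine ⟨fun j => if h : j < J then (c ⟨j, h⟩).1 else 0,
    fun j => if h : j < J then (c ⟨j, h⟩).2 else 0, ?_, ?_, ?_, ?_⟩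
  · intro j
    dsimp only
    split_ifs
    · exact mem_degreeLT.1 (c _).1.2
    · simp
  · intro j
    dsimp only
    split_ifs
    · exact mem_degreeLT.1 (c _).2.2
    · simp
  · obtain ⟨j, hj⟩ := Function.ne_iff.1 hc0
    refine ⟨j, j.2, fun h => hj ?_⟩
    simp only [j.2, dif_pos, ZeroMemClass.coe_eq_zero] at h
    exact Prod.ext h.1 h.2
  · intro k hk
    set P := ∑ j : Fin J, stepanovCondition f ε v k j (((c j).1 : K[X]), ((c j).2 : K[X]))
      with hP
    have h1 : P = 0 := by
      ext i
      by_cases hi : i < D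
      · have := congrFun (congrFun (LinearMap.mem_ker.1 hc) ⟨k, hk⟩) ⟨i, hi⟩
        simpa [Φ, ev, hP] using this
      · rw [coeff_zero]
        apply coeff_eq_zero_of_natDegree_lt
        refine lt_of_lt_of_le ?_ (not_lt.1 hi)
        have hlt : P.natDegree ≤ D - 1 := natDegree_sum_le_of_forall_le _ _ fun j _ => by
          have := natDegree_stepanovCondition_lt ε hv hN j.2 hk
            (mem_degreeLT.1 (c j).1.2) (mem_degreeLT.1 (c j).2.2)
          omega
        omega
    rw [Finset.sum_range]
    rw [← h1, hP]
    exact Finset.sum_congr rfl fun j _ => by simp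

open Polynomial in
theorem X_sub_C_pow_dvd_of_hasseDeriv_eval_eq_zero {K : Type*} [Field K] {p : K[X]} {x : K}
    {ℓ : ℕ} (h : ∀ k < ℓ, (hasseDeriv k p).eval x = 0) : (X - C x) ^ ℓ ∣ p := by
  rw [X_sub_C_pow_dvd_iff, ← taylor_apply, X_pow_dvd_iff]
  intro k hk
  rw [taylor_coeff, h k hk]

open Polynomial in
/-- **Stepanov's bound.** Over a field with `s ^ 2` elements, `f ^ ((s ^ 2 - 1) / 2)` takes each
nonzero value at no more than about half of the points: the auxiliary polynomial vanishes to
order `s` at each of them, and its degree is about `s * s ^ 2 / 2`. -/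
theorem two_mul_card_eval_pow_eq_le {K : Type*} [Field K] [Fintype K] [DecidableEq K] {f : K[X]}
    (hf : Squarefree f) (hd : 0 < f.natDegree) (h0 : f.eval 0 ≠ 0) {M s : ℕ}
    (hM : 2 * M + 1 = Fintype.card K) (hs : Fintype.card K = s ^ 2) (hodd : Odd s)
    (hlarge : 2 * f.natDegree + 3 ≤ s) {ε : K} (hε : ε ≠ 0) :
    2 * (Finset.univ.filter fun x : K => f.eval x ^ M = ε).card
      ≤ s ^ 2 + (3 * f.natDegree + 4) * s := by
  set d := f.natDegree with hdd
  -- The coefficients have degree below `N`, about `s ^ 2 / 2`, the largest for which the auxiliary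
  -- polynomial cannot vanish identically; `J` exceeds `s / 2` by just enough for the coefficients
  -- to outnumber the conditions of order `s`.
  obtain ⟨J, hJ⟩ : ∃ J, 2 * J = s + 2 * d + 3 := by
    obtain ⟨a, ha⟩ := hodd
    exact ⟨a + d + 2, by omega⟩
  have hsd : d ≤ s ^ 2 := by nlinarith
  obtain ⟨N, hN1, hN2⟩ : ∃ N, 2 * N + d ≤ s ^ 2 + 1 ∧ s ^ 2 ≤ 2 * N + d :=
    ⟨(s ^ 2 + 1 - d) / 2, by omega, by omega⟩
  have hN : 0 < N := by
    by_contra h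
    have : N = 0 := by omega
    subst this
    nlinarith
  have hcount : s * (N + J + s * d) < J * (N + N) := by
    zify at *
    nlinarith
  choose v hv hvdeg using exists_hasseDeriv_pow_mul f M
  obtain ⟨r, t, hr, ht, hne, hcond⟩ := exists_stepanov_coefficients f ε v hvdeg hN hcount
  set Q := Fintype.card K with hQ
  set P : K[X] := ∑ j ∈ Finset.range J, (r j + t j * f ^ M) * X ^ (j * Q) with hP
  have hP0 : P ≠ 0 := by
    intro h
    obtain ⟨j, hj, hj0⟩ := hne
    exact hj0 (eq_zero_of_sum_add_mul_pow_eq_zero hf hd h0 hM (by rw [← hQ, hs]; exact hN1)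
      J r t hr ht h j hj)
  have hsQ : s ≤ Q := by nlinarith
  have hM0 : M ≠ 0 := by
    rintro rfl
    nlinarith
  set S := Finset.univ.filter fun x : K => f.eval x ^ M = ε with hS
  have hdvd : ∏ x ∈ S, (X - C x) ^ s ∣ P := by
    refine Finset.prod_dvd_of_coprime ?_ ?_
    · intro x _ y _ hxy
      exact (isCoprime_X_sub_C_of_isUnit_sub (sub_ne_zero.2 hxy).isUnit).pow
    · intro x hx
      have hx : f.eval x ^ M = ε := (Finset.mem_filter.1 hx).2
      have hfx : f.eval x ≠ 0 := by
        intro h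
        rw [h, zero_pow hM0] at hx
        exact hε hx.symm
      refine X_sub_C_pow_dvd_of_hasseDeriv_eval_eq_zero fun k hk => ?_
      have h1 := congrArg (eval x) (hcond k hk)
      rw [eval_finsetSum, Finset.sum_congr rfl fun j _ => eval_stepanovCondition hv
        (hk.trans_le hsQ) j (r j) (t j) hx, ← Finset.mul_sum, eval_zero] at h1
      rw [hP, map_sum, eval_finsetSum]
      exact (mul_eq_zero.1 h1).resolve_left (pow_ne_zero _ hfx)
  have hdeg := natDegree_le_of_dvd hdvd hP0
  rw [natDegree_prod_of_monic _ _ fun x _ => (monic_X_sub_C x).pow s] at hdeg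
  simp only [natDegree_pow, natDegree_X_sub_C, mul_one, Finset.sum_const, smul_eq_mul] at hdeg
  have hPdeg : P.natDegree ≤ N + M * d + J * Q := by
    refine natDegree_sum_le_of_forall_le _ _ fun j hj => ?_
    have hj := Finset.mem_range.1 hj
    have hnat : ∀ {p : K[X]}, p.degree < N → p.natDegree ≤ N := fun {p} hp =>
      natDegree_le_of_degree_le hp.le
    have h1 : (r j + t j * f ^ M).natDegree ≤ N + M * d :=
      natDegree_add_le_of_degree_le ((hnat (hr j)).trans (Nat.le_add_right _ _))
        (natDegree_mul_le_of_le (hnat (ht j)) natDegree_pow_le)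
    refine natDegree_mul_le_of_le h1 ?_
    rw [natDegree_X_pow]
    exact Nat.mul_le_mul_right _ hj.le
  have hs0 : 0 < s := by omega
  have h2 : S.card * s ≤ N + M * d + J * Q := hdeg.trans hPdeg
  refine Nat.le_of_mul_le_mul_right ?_ hs0
  rw [hs] at h2 hM
  clear_value d S Q
  have e1 : 2 * M * d + d = s ^ 2 * d := by rw [← hM]; ring
  have e2 : 2 * J * s ^ 2 = (s + 2 * d + 3) * s ^ 2 := by rw [hJ]
  nlinarith

/-! ### Quadratic character sums over a conic -/

/-- The quadratic character sum `∑ η(r² - k)` with `k ≠ 0`: the hyperbola `r² - y² = k` has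
`q - 1` points. -/
theorem sum_quadraticChar_sq_sub {F : Type*} [Field F] [Fintype F] [DecidableEq F]
    (hF : ringChar F ≠ 2) {k : F} (hk : k ≠ 0) : ∑ r : F, quadraticChar F (r ^ 2 - k) = -1 := by
  have h2 : (2 : F) ≠ 0 := Ring.two_ne_zero hF
  have h1 : ∑ r : F, (quadraticChar F (r ^ 2 - k) + 1) = Fintype.card F - 1 := by
    calc ∑ r : F, (quadraticChar F (r ^ 2 - k) + 1)
        = ∑ r : F, ((Finset.univ.filter fun y : F => y ^ 2 = r ^ 2 - k).card : ℤ) := by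
          refine Finset.sum_congr rfl fun r _ => ?_
          rw [← quadraticChar_card_sqrts hF]
          congr 2
          ext y
          simp
      _ = ((Finset.univ.filter fun p : F × F => p.2 ^ 2 = p.1 ^ 2 - k).card : ℤ) := by
          simp only [Finset.card_filter, Fintype.sum_prod_type]
          push_cast
          rfl
      -- The coordinate `u = r - y` parametrizes the hyperbola, since `r + y = k / u`.
      _ = ((Finset.univ.filter fun u : F => u ≠ 0).card : ℤ) := by
          congr 1
          refine Finset.card_nbij' (fun p => p.1 - p.2)
            (fun u => ((k / u + u) / 2, (k / u - u) / 2))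
            ?_ ?_ ?_ ?_
          · rintro ⟨r, y⟩ h
            simp only [Finset.coe_filter, Finset.mem_univ, true_and, Set.mem_ofPred_eq] at h ⊢
            intro h3
            apply hk
            linear_combination (r + y) * h3 + h
          · intro u hu
            simp only [Finset.coe_filter, Finset.mem_univ, true_and, Set.mem_ofPred_eq] at hu ⊢
            field_simp
            ring
          · rintro ⟨r, y⟩ h
            simp only [Finset.coe_filter, Finset.mem_univ, true_and, Set.mem_ofPred_eq] at h
            have h3 : r - y ≠ 0 := by
              intro h3
              apply hk
              linear_combination (r + y) * h3 + h
            have h4 : k / (r - y) = r + y := by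
              rw [div_eq_iff h3]
              linear_combination h
            simp only [h4, Prod.mk.injEq]
            constructor
            · field_simp
              ring
            · field_simp
              ring
          · intro u hu
            have hu : u ≠ 0 := by simpa using hu
            field_simp
            ring
      _ = Fintype.card F - 1 := by
          rw [Finset.filter_ne', Finset.card_erase_of_mem (Finset.mem_univ _), Finset.card_univ,
            Nat.cast_sub Fintype.card_pos, Nat.cast_one]
  rw [Finset.sum_add_distrib] at h1
  simp only [Finset.sum_const, Finset.card_univ, nsmul_eq_mul, mul_one] at h1
  linarith

/-! ### Monic polynomials over a finite field -/

open Polynomial in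
theorem finite_setOf_monic_natDegree_eq (F : Type*) [Field F] [Finite F] (n : ℕ) :
    {f : F[X] | f.Monic ∧ f.natDegree = n}.Finite := by
  have : Finite (degreeLT F (n + 1)) := Finite.of_equiv _ (degreeLTEquiv F (n + 1)).symm.toEquiv
  refine Set.Finite.subset (Set.toFinite (degreeLT F (n + 1) : Set F[X])) ?_
  rintro f ⟨-, hf⟩
  rw [SetLike.mem_coe, mem_degreeLT]
  exact degree_le_natDegree.trans_lt (by rw [hf]; exact_mod_cast Nat.lt_succ_self n)

open Polynomial in
/-- The finite set of monic polynomials of degree `n` over a finite field. -/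
noncomputable def monicsOfDegree (F : Type*) [Field F] [Finite F] (n : ℕ) : Finset F[X] :=
  (finite_setOf_monic_natDegree_eq F n).toFinset

open Polynomial in
@[simp]
theorem mem_monicsOfDegree {F : Type*} [Field F] [Finite F] {n : ℕ} {f : F[X]} :
    f ∈ monicsOfDegree F n ↔ f.Monic ∧ f.natDegree = n := by
  simp [monicsOfDegree]

open Polynomial Classical in
/-- The finite set of monic irreducible polynomials whose degree divides `k`; it is empty for
`k = 0`. -/
noncomputable def irreduciblesOfDegreeDvd (F : Type*) [Field F] [Finite F] (k : ℕ) : Finset F[X] :=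
  ((Finset.range (k + 1)).biUnion (monicsOfDegree F)).filter
    fun P => Irreducible P ∧ P.natDegree ∣ k ∧ k ≠ 0

open Polynomial in
theorem mem_irreduciblesOfDegreeDvd {F : Type*} [Field F] [Finite F] {k : ℕ} {P : F[X]} :
    P ∈ irreduciblesOfDegreeDvd F k ↔ P.Monic ∧ Irreducible P ∧ P.natDegree ∣ k ∧ k ≠ 0 := by
  classical
  simp only [irreduciblesOfDegreeDvd, Finset.mem_filter, Finset.mem_biUnion, Finset.mem_range,
    mem_monicsOfDegree]
  constructor
  · rintro ⟨⟨e, he, h1, h2⟩, h3⟩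
    exact ⟨h1, h3⟩
  · rintro ⟨h1, h2, h3, h4⟩
    exact ⟨⟨P.natDegree, Nat.lt_succ_of_le (Nat.le_of_dvd (Nat.pos_of_ne_zero h4) h3), h1, rfl⟩,
      h2, h3, h4⟩

open Polynomial UniqueFactorizationMonoid in
theorem pow_dvd_iff_le_count_normalizedFactors {F : Type*} [Field F] [DecidableEq F]
    {f P : F[X]} (hf : f ≠ 0) (hP : Irreducible P) (hPm : P.Monic) (j : ℕ) :
    P ^ j ∣ f ↔ j ≤ (normalizedFactors f).count P := by
  rw [pow_dvd_iff_le_emultiplicity, emultiplicity_eq_count_normalizedFactors hP hf,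
    hPm.normalize_eq_self, Nat.cast_le]

open Polynomial UniqueFactorizationMonoid in
/-- The number of positive multiples `k` of `deg P` with `P ^ (k / deg P) ∣ f` is the multiplicity
of `P` in `f`. -/
theorem card_filter_pow_dvd_eq_count {F : Type*} [Field F] [DecidableEq F]
    {f P : F[X]} (hf : f ≠ 0) (hP : Irreducible P) (hPm : P.Monic) :
    Set.ncard {k ∈ Set.Icc 1 f.natDegree | P.natDegree ∣ k ∧ P ^ (k / P.natDegree) ∣ f} =
      (normalizedFactors f).count P := by
  have hdeg : 0 < P.natDegree := hP.natDegree_pos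
  have h1 : {k ∈ Set.Icc 1 f.natDegree | P.natDegree ∣ k ∧ P ^ (k / P.natDegree) ∣ f} =
      ((Finset.Icc 1 ((normalizedFactors f).count P)).image (P.natDegree * ·) : Finset ℕ) := by
    ext k
    simp only [Set.mem_ofPred_eq, Set.mem_Icc, Finset.coe_image, Finset.coe_Icc, Set.mem_image]
    constructor
    · rintro ⟨⟨hk1, hk2⟩, ⟨j, rfl⟩, hdvd⟩
      rw [Nat.mul_div_cancel_left _ hdeg] at hdvd
      refine ⟨j, ⟨Nat.pos_of_mul_pos_left hk1,
        (pow_dvd_iff_le_count_normalizedFactors hf hP hPm j).1 hdvd⟩, rfl⟩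
    · rintro ⟨j, ⟨hj1, hj2⟩, rfl⟩
      have hdvd := (pow_dvd_iff_le_count_normalizedFactors hf hP hPm j).2 hj2
      refine ⟨⟨Nat.mul_pos hdeg hj1, ?_⟩, Dvd.intro _ rfl, ?_⟩
      · have := natDegree_le_of_dvd hdvd hf
        rwa [natDegree_pow, mul_comm] at this
      · rwa [Nat.mul_div_cancel_left _ hdeg]
  rw [h1, Set.ncard_coe_finset, Finset.card_image_of_injective _
    (mul_right_injective₀ hdeg.ne'), Nat.card_Icc, Nat.add_sub_cancel]

open Polynomial UniqueFactorizationMonoid in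
/-- The identity `log f = ∑ Λ(d)` over the divisors `d` of `f`, for the von Mangoldt function on
polynomials: `Λ(P ^ j) = deg P`. -/
theorem sum_natDegree_of_pow_dvd {F : Type*} [Field F] [Finite F] {f : F[X]} (hf : f.Monic) :
    ∑ k ∈ Finset.Icc 1 f.natDegree, ∑ P ∈ irreduciblesOfDegreeDvd F k,
      (open Classical in if P ^ (k / P.natDegree) ∣ f then P.natDegree else 0) = f.natDegree := by
  classical
  set n := f.natDegree with hn
  set T := (Finset.Icc 1 n).biUnion (irreduciblesOfDegreeDvd F) with hT
  have hTmem : ∀ P ∈ T, P.Monic ∧ Irreducible P := by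
    intro P hP
    obtain ⟨k, -, hk⟩ := Finset.mem_biUnion.1 hP
    exact ⟨(mem_irreduciblesOfDegreeDvd.1 hk).1, (mem_irreduciblesOfDegreeDvd.1 hk).2.1⟩
  calc _ = ∑ k ∈ Finset.Icc 1 n, ∑ P ∈ T,
        (if P.natDegree ∣ k ∧ P ^ (k / P.natDegree) ∣ f then P.natDegree else 0) := by
        refine Finset.sum_congr rfl fun k hk => ?_
        have hsub : irreduciblesOfDegreeDvd F k ⊆ T := Finset.subset_biUnion_of_mem _ hk
        rw [← Finset.sum_subset hsub]
        · refine Finset.sum_congr rfl fun P hP => ?_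
          simp only [(mem_irreduciblesOfDegreeDvd.1 hP).2.2.1, true_and]
        · intro P hP hP'
          rw [if_neg]
          rintro ⟨h, -⟩
          refine hP' (mem_irreduciblesOfDegreeDvd.2 ⟨(hTmem P hP).1, (hTmem P hP).2, h, ?_⟩)
          have := (Finset.mem_Icc.1 hk).1
          omega
    _ = ∑ P ∈ T, (normalizedFactors f).count P * P.natDegree := by
        rw [Finset.sum_comm]
        refine Finset.sum_congr rfl fun P hP => ?_
        rw [← card_filter_pow_dvd_eq_count hf.ne_zero (hTmem P hP).2 (hTmem P hP).1,
          ← Finset.sum_filter, Finset.sum_const, smul_eq_mul]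
        congr 1
        rw [← Set.ncard_coe_finset]
        congr 1
        ext k
        simp [hn]
    _ = ∑ P ∈ (normalizedFactors f).toFinset, (normalizedFactors f).count P * P.natDegree := by
        refine (Finset.sum_subset ?_ ?_).symm
        · intro P hP
          have hP := Multiset.mem_toFinset.1 hP
          have hirr := irreducible_of_normalized_factor P hP
          have hmon : P.Monic := by
            rw [← normalize_normalized_factor P hP]
            exact monic_normalize hirr.ne_zero
          refine Finset.mem_biUnion.2 ⟨P.natDegree, Finset.mem_Icc.2 ⟨hirr.natDegree_pos,
            natDegree_le_of_dvd (dvd_of_mem_normalizedFactors hP) hf.ne_zero⟩, ?_⟩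
          exact mem_irreduciblesOfDegreeDvd.2 ⟨hmon, hirr, dvd_rfl, hirr.natDegree_pos.ne'⟩
        · intro P _ hP
          rw [Multiset.mem_toFinset] at hP
          rw [Multiset.count_eq_zero_of_notMem hP, zero_mul]
    _ = ((normalizedFactors f).map natDegree).sum := by
        rw [Finset.sum_multiset_map_count]
        rfl
    _ = n := by
        have hmon : ∀ P ∈ normalizedFactors f, P.Monic := by
          intro P hP
          rw [← normalize_normalized_factor P hP]
          exact monic_normalize (irreducible_of_normalized_factor P hP).ne_zero
        rw [← natDegree_multiset_prod_of_monic _ hmon]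
        exact natDegree_eq_of_degree_eq
          (degree_eq_degree_of_associated (prod_normalizedFactors hf.ne_zero))

open Polynomial in
/-- **Logarithmic derivative of an Euler product**, coefficientwise: for a weight on monic
polynomials that is completely multiplicative, the sums `c n` of the weight over monic polynomials
of degree `n` and the sums over prime powers satisfy Newton's identities. -/
theorem natCast_mul_sum_monicsOfDegree {F : Type*} [Field F] [Finite F] (w : F[X] → ℂ)
    (h1 : w 1 = 1) (hmul : ∀ f g : F[X], f.Monic → g.Monic → w (f * g) = w f * w g) (n : ℕ) :
    (n : ℂ) * ∑ f ∈ monicsOfDegree F n, w f =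
      ∑ k ∈ Finset.Icc 1 n, (∑ P ∈ irreduciblesOfDegreeDvd F k,
        (P.natDegree : ℂ) * w P ^ (k / P.natDegree)) * ∑ g ∈ monicsOfDegree F (n - k), w g := by
  classical
  have hpow : ∀ (P : F[X]) (j : ℕ), P.Monic → w (P ^ j) = w P ^ j := by
    intro P j hP
    induction j with
    | zero => simpa using h1
    | succ j ih => rw [pow_succ, hmul _ _ (hP.pow j) hP, ih, pow_succ]
  have key : ∀ k ∈ Finset.Icc 1 n, ∀ P ∈ irreduciblesOfDegreeDvd F k,
      (P.natDegree : ℂ) * w P ^ (k / P.natDegree) * ∑ g ∈ monicsOfDegree F (n - k), w g =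
        ∑ f ∈ monicsOfDegree F n,
          w f * ((if P ^ (k / P.natDegree) ∣ f then P.natDegree else 0 : ℕ) : ℂ) := by
    intro k hk P hP
    obtain ⟨hPm, hPi, hPd, hk0⟩ := mem_irreduciblesOfDegreeDvd.1 hP
    have hkn := (Finset.mem_Icc.1 hk).2
    set R := P ^ (k / P.natDegree) with hR
    have hRm : R.Monic := hPm.pow _
    have hRd : R.natDegree = k := by
      rw [hR, natDegree_pow, Nat.div_mul_cancel hPd]
    have hbij : ∑ g ∈ monicsOfDegree F (n - k), w (R * g) =
        ∑ f ∈ (monicsOfDegree F n).filter (R ∣ ·), w f := by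
      refine Finset.sum_bij (fun g _ => R * g) ?_ ?_ ?_ (fun _ _ => rfl)
      · intro g hg
        obtain ⟨hgm, hgd⟩ := mem_monicsOfDegree.1 hg
        rw [Finset.mem_filter, mem_monicsOfDegree]
        refine ⟨⟨hRm.mul hgm, ?_⟩, Dvd.intro _ rfl⟩
        rw [hRm.natDegree_mul hgm, hRd, hgd]
        omega
      · intro g _ g' _ h
        exact mul_left_cancel₀ hRm.ne_zero h
      · intro f hf
        rw [Finset.mem_filter, mem_monicsOfDegree] at hf
        obtain ⟨⟨hfm, hfd⟩, g, rfl⟩ := hf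
        have hgm : g.Monic := hRm.of_mul_monic_left hfm
        refine ⟨g, mem_monicsOfDegree.2 ⟨hgm, ?_⟩, rfl⟩
        rw [hRm.natDegree_mul hgm, hRd] at hfd
        omega
    calc _ = (P.natDegree : ℂ) * ∑ g ∈ monicsOfDegree F (n - k), w (R * g) := by
          rw [mul_assoc, Finset.mul_sum]
          congr 1
          refine Finset.sum_congr rfl fun g hg => ?_
          rw [hmul _ _ hRm (mem_monicsOfDegree.1 hg).1, hR, hpow _ _ hPm]
      _ = _ := by
          rw [hbij, Finset.sum_filter, Finset.mul_sum]
          refine Finset.sum_congr rfl fun f _ => ?_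
          split_ifs <;> simp [mul_comm]
  calc (n : ℂ) * ∑ f ∈ monicsOfDegree F n, w f
      = ∑ f ∈ monicsOfDegree F n, w f * (∑ k ∈ Finset.Icc 1 n,
          ∑ P ∈ irreduciblesOfDegreeDvd F k,
            (if P ^ (k / P.natDegree) ∣ f then P.natDegree else 0) : ℕ) := by
        rw [Finset.mul_sum]
        refine Finset.sum_congr rfl fun f hf => ?_
        obtain ⟨hfm, rfl⟩ := mem_monicsOfDegree.1 hf
        rw [sum_natDegree_of_pow_dvd hfm, mul_comm]
    _ = ∑ k ∈ Finset.Icc 1 n, ∑ P ∈ irreduciblesOfDegreeDvd F k, ∑ f ∈ monicsOfDegree F n,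
          w f * ((if P ^ (k / P.natDegree) ∣ f then P.natDegree else 0 : ℕ) : ℂ) := by
        simp only [Nat.cast_sum, Finset.mul_sum]
        rw [Finset.sum_comm]
        refine Finset.sum_congr rfl fun k _ => ?_
        rw [Finset.sum_comm]
    _ = _ := by
        refine Finset.sum_congr rfl fun k hk => ?_
        rw [Finset.sum_mul]
        exact Finset.sum_congr rfl fun P hP => (key k hk P hP).symm

/-! ### The L-function of the conic sum -/

open Polynomial in
/-- The completely multiplicative weight on monic polynomials with value `χ(α) η(α² - m)` at
`X - α`. The determinant of `f` at a matrix with square `m` is the norm of `f(√m)`, which makes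
sense whether or not `m` is a square. -/
noncomputable def conicWeight {F : Type*} [Field F] [Fintype F] [DecidableEq F]
    (χ : AddChar F ℂ) (m : F) (f : F[X]) : ℂ :=
  χ (-f.nextCoeff) * (quadraticChar F (aeval (!![0, m; 1, 0] : Matrix (Fin 2) (Fin 2) F) f).det : ℂ)

section ConicWeight

variable {F : Type*} [Field F] [Fintype F] [DecidableEq F] (χ : AddChar F ℂ) (m : F)

open Polynomial

theorem conicWeight_one : conicWeight χ m 1 = 1 := by
  have : (1 : F[X]).nextCoeff = 0 := by rw [← C_1, nextCoeff_C_eq_zero]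
  simp [conicWeight, this]

theorem conicWeight_mul {f g : F[X]} (hf : f.Monic) (hg : g.Monic) :
    conicWeight χ m (f * g) = conicWeight χ m f * conicWeight χ m g := by
  simp only [conicWeight, hf.nextCoeff_mul hg, neg_add, AddChar.map_add_eq_mul, map_mul,
    Matrix.det_mul, Int.cast_mul]
  ring

theorem conicWeight_X_sub_C (a : F) :
    conicWeight χ m (X - C a) = χ a * (quadraticChar F (a ^ 2 - m) : ℂ) := by
  rw [conicWeight, nextCoeff_X_sub_C, neg_neg]
  congr 3
  simp [Matrix.det_fin_two, sq, Matrix.algebraMap_eq_diagonal]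

theorem sum_conicWeight_zero : ∑ f ∈ monicsOfDegree F 0, conicWeight χ m f = 1 := by
  have : monicsOfDegree F 0 = {1} := by
    ext f
    simp only [mem_monicsOfDegree, Finset.mem_singleton]
    exact ⟨fun h => h.1.natDegree_eq_zero.1 h.2, by rintro rfl; simp⟩
  rw [this, Finset.sum_singleton, conicWeight_one]

theorem sum_conicWeight_one : ∑ f ∈ monicsOfDegree F 1, conicWeight χ m f =
    ∑ z : F, χ z * (quadraticChar F (z ^ 2 - m) : ℂ) := by
  symm
  refine Finset.sum_bij (fun a _ => X - C a) ?_ ?_ ?_ ?_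
  · intro a _
    exact mem_monicsOfDegree.2 ⟨monic_X_sub_C a, natDegree_X_sub_C a⟩
  · intro a _ b _ h
    simpa using h
  · intro f hf
    obtain ⟨hm, hd⟩ := mem_monicsOfDegree.1 hf
    refine ⟨-f.coeff 0, Finset.mem_univ _, ?_⟩
    rw [hm.eq_X_add_C hd]
    simp
  · intro a _
    rw [conicWeight_X_sub_C]

theorem sum_conicWeight_two (hF : ringChar F ≠ 2) {χ : AddChar F ℂ} (hχ : χ ≠ 1) {m : F}
    (hm : m ≠ 0) : ∑ f ∈ monicsOfDegree F 2, conicWeight χ m f = Fintype.card F := by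
  have hw : ∀ a b : F, conicWeight χ m (X ^ 2 + C a * X + C b) =
      χ (-a) * (quadraticChar F ((b + m) ^ 2 - a ^ 2 * m) : ℂ) := by
    intro a b
    have h1 : (X ^ 2 + C a * X + C b : F[X]).natDegree = 2 := by compute_degree!
    have h2 : (X ^ 2 + C a * X + C b : F[X]).nextCoeff = a := by
      rw [nextCoeff_of_natDegree_pos (by omega), h1]
      simp [coeff_C]
    rw [conicWeight, h2]
    congr 3
    simp [Matrix.det_fin_two, sq, Matrix.algebraMap_eq_diagonal]
    ring
  have h1 : ∑ f ∈ monicsOfDegree F 2, conicWeight χ m f =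
      ∑ p : F × F, conicWeight χ m (X ^ 2 + C p.1 * X + C p.2) := by
    symm
    refine Finset.sum_bij (fun p _ => X ^ 2 + C p.1 * X + C p.2) ?_ ?_ ?_ (fun _ _ => rfl)
    · rintro ⟨a, b⟩ _
      rw [mem_monicsOfDegree]
      constructor
      · monicity!
      · compute_degree!
    · rintro ⟨a, b⟩ _ ⟨a', b'⟩ _ h
      have e0 := congrArg (coeff · 0) h
      have e1 := congrArg (coeff · 1) h
      simp [coeff_X, coeff_C] at e0 e1
      rw [e0, e1]
    · intro f hf
      obtain ⟨hfm, hd⟩ := mem_monicsOfDegree.1 hf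
      refine ⟨(f.coeff 1, f.coeff 0), Finset.mem_univ _, ?_⟩
      conv_rhs => rw [hfm.as_sum, hd, Finset.sum_range_succ, Finset.sum_range_one]
      simp only [pow_zero, pow_one, mul_one]
      ring
  have h2 : ∀ a : F, ∑ b : F, (quadraticChar F ((b + m) ^ 2 - a ^ 2 * m) : ℂ) =
      -1 + if a = 0 then (Fintype.card F : ℂ) else 0 := by
    intro a
    have hshift : ∑ b : F, (quadraticChar F ((b + m) ^ 2 - a ^ 2 * m) : ℂ) =
        ∑ r : F, (quadraticChar F (r ^ 2 - a ^ 2 * m) : ℂ) :=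
      Equiv.sum_comp (Equiv.addRight m) (fun r => (quadraticChar F (r ^ 2 - a ^ 2 * m) : ℂ))
    rw [hshift, ← Int.cast_sum]
    by_cases ha : a = 0
    · have : ∀ r : F, quadraticChar F (r ^ 2 - a ^ 2 * m) = 1 - if r = 0 then 1 else 0 := by
        intro r
        rw [ha, zero_pow two_ne_zero, zero_mul, sub_zero]
        by_cases hr : r = 0
        · rw [hr, zero_pow two_ne_zero, quadraticChar_zero, if_pos rfl, sub_self]
        · rw [quadraticChar_sq_one' hr, if_neg hr, sub_zero]
      rw [Finset.sum_congr rfl fun r _ => this r, if_pos ha]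
      simp
      ring
    · rw [sum_quadraticChar_sq_sub hF (mul_ne_zero (pow_ne_zero 2 ha) hm)]
      simp [ha]
  rw [h1, Fintype.sum_prod_type]
  simp only [hw, ← Finset.mul_sum, h2, mul_add, Finset.sum_add_distrib, ← Finset.sum_mul]
  have h3 : ∑ a : F, χ (-a) = 0 := by
    rw [← AddChar.sum_eq_zero_of_ne_one hχ]
    exact Equiv.sum_comp (Equiv.neg F) (fun a => χ a)
  rw [h3]
  simp

/-- Adding multiples of `X ^ (n - 3) * (X ^ 2 - m)` moves the second coefficient of a polynomial
of degree `n` and leaves its values at the square roots of `m` alone, so that the sum is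
multiplied by a nontrivial character value. -/
theorem sum_conicWeight_eq_zero {χ : AddChar F ℂ} (hχ : χ ≠ 1) (m : F) {n : ℕ} (hn : 3 ≤ n) :
    ∑ f ∈ monicsOfDegree F n, conicWeight χ m f = 0 := by
  obtain ⟨k, rfl⟩ : ∃ k, n = k + 3 := ⟨n - 3, by omega⟩
  obtain ⟨t, ht⟩ := AddChar.ne_one_iff.1 hχ
  have hdegree : ∀ s : F, (C s * (X ^ k * (X ^ 2 - C m))).degree < ((k + 3 : ℕ) : WithBot ℕ) := by
    intro s
    refine (degree_le_natDegree).trans_lt ?_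
    have : (C s * (X ^ k * (X ^ 2 - C m))).natDegree ≤ k + 2 := by compute_degree
    exact_mod_cast Nat.lt_succ_of_le this
  have hmem : ∀ (s : F), ∀ f ∈ monicsOfDegree F (k + 3),
      f + C s * (X ^ k * (X ^ 2 - C m)) ∈ monicsOfDegree F (k + 3) := by
    intro s f hf
    obtain ⟨hfm, hfd⟩ := mem_monicsOfDegree.1 hf
    have hlt : (C s * (X ^ k * (X ^ 2 - C m))).degree < f.degree := by
      rw [degree_eq_natDegree hfm.ne_zero, hfd]
      exact hdegree s
    refine mem_monicsOfDegree.2 ⟨hfm.add_of_left hlt, ?_⟩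
    rw [← hfd]
    exact natDegree_eq_of_degree_eq (degree_add_eq_left_of_degree_lt hlt)
  have hw : ∀ f ∈ monicsOfDegree F (k + 3),
      conicWeight χ m (f + C (-t) * (X ^ k * (X ^ 2 - C m))) = χ t * conicWeight χ m f := by
    intro f hf
    have hd := (mem_monicsOfDegree.1 hf).2
    have hd' := (mem_monicsOfDegree.1 (hmem (-t) f hf)).2
    have h1 : (f + C (-t) * (X ^ k * (X ^ 2 - C m))).nextCoeff = f.nextCoeff - t := by
      rw [nextCoeff_of_natDegree_pos (by omega), nextCoeff_of_natDegree_pos (by omega), hd, hd',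
        coeff_add, coeff_C_mul, show k + 3 - 1 = 2 + k by omega, coeff_X_pow_mul]
      simp
      ring
    have h2 : aeval (!![0, m; 1, 0] : Matrix (Fin 2) (Fin 2) F) (X ^ 2 - C m : F[X]) = 0 := by
      ext i j
      fin_cases i <;> fin_cases j <;> simp [sq, Matrix.algebraMap_eq_diagonal]
    rw [conicWeight, conicWeight, h1, neg_sub, sub_eq_add_neg, AddChar.map_add_eq_mul, map_add,
      map_mul, map_mul, h2, mul_zero, mul_zero, add_zero, mul_assoc]
  have h3 : ∑ f ∈ monicsOfDegree F (k + 3), conicWeight χ m f =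
      χ t * ∑ f ∈ monicsOfDegree F (k + 3), conicWeight χ m f := by
    conv_lhs => rw [← Finset.sum_bij' (fun f _ => f + C (-t) * (X ^ k * (X ^ 2 - C m)))
      (fun f _ => f + C t * (X ^ k * (X ^ 2 - C m))) (hmem (-t)) (hmem t)
      (fun f _ => by rw [C_neg]; ring) (fun f _ => by rw [C_neg]; ring) (fun f hf => rfl)]
    rw [Finset.sum_congr rfl hw, Finset.mul_sum]
  have h4 : (χ t - 1) * ∑ f ∈ monicsOfDegree F (k + 3), conicWeight χ m f = 0 := by
    rw [sub_mul, one_mul, ← h3, sub_self]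
  exact (mul_eq_zero.1 h4).resolve_left (sub_ne_zero.2 ht)

end ConicWeight

/-- Newton's identities for an L-function `1 + a T + b T²` determine the power sums. -/
theorem powerSum_of_newton {a b : ℂ} {c p : ℕ → ℂ} (h0 : c 0 = 1) (h1 : c 1 = a) (h2 : c 2 = b)
    (h3 : ∀ n, 3 ≤ n → c n = 0)
    (hnewton : ∀ n : ℕ, (n : ℂ) * c n = ∑ k ∈ Finset.Icc 1 n, p k * c (n - k))
    {x y : ℂ} (hadd : x + y = -a) (hmul : x * y = b) (n : ℕ) (hn : 1 ≤ n) :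
    p n = -(x ^ n + y ^ n) := by
  have p1 : p 1 = a := by
    have := hnewton 1
    simp [h0, h1] at this
    exact this.symm
  have p2 : p 2 = 2 * b - a ^ 2 := by
    have := hnewton 2
    rw [Finset.sum_Icc_succ_top (by norm_num)] at this
    simp [h0, h1, h2, p1] at this
    linear_combination -this
  have hrec : ∀ n, p (n + 3) = -(a * p (n + 2) + b * p (n + 1)) := by
    intro n
    have h4 := hnewton (n + 3)
    rw [h3 (n + 3) (by omega), mul_zero, Finset.sum_Icc_succ_top (by omega),
      Finset.sum_Icc_succ_top (by omega), Finset.sum_Icc_succ_top (by omega),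
      Finset.sum_eq_zero] at h4
    · rw [show n + 3 - (n + 1) = 2 by omega, show n + 3 - (n + 1 + 1) = 1 by omega,
        show n + 3 - (n + 2 + 1) = 0 by omega, h0, h1, h2] at h4
      linear_combination -h4
    · intro k hk
      have := Finset.mem_Icc.1 hk
      rw [h3 _ (by omega), mul_zero]
  have hb : b = x * y := hmul.symm
  have ha : a = -(x + y) := by rw [hadd, neg_neg]
  obtain ⟨n, rfl⟩ : ∃ k, n = k + 1 := ⟨n - 1, by omega⟩
  clear hn
  induction n using Nat.strong_induction_on with
  | _ n ih =>
    match n with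
    | 0 => rw [zero_add, p1, ha]; ring
    | 1 => rw [show 1 + 1 = 2 from rfl, p2, ha, hb]; ring
    | n + 2 =>
      rw [hrec n, ih n (by omega), ih (n + 1) (by omega), ha, hb]
      ring

/-! ### Sums over extension fields as sums over prime polynomials -/

section ExtensionSum

open Polynomial

/-- For a primitive element `g` of `E / F`, the norm of `g² - m` is the norm of `f(√m)`, where `f`
is the minimal polynomial of `g`. -/
theorem norm_gen_sq_sub_eq_det {F E : Type*} [Field F] [Field E] [Algebra F E]
    [FiniteDimensional F E] [Algebra.IsSeparable F E] (pb : PowerBasis F E) (m : F) :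
    Algebra.norm F (pb.gen ^ 2 - algebraMap F E m) =
      (aeval (!![0, m; 1, 0] : Matrix (Fin 2) (Fin 2) F) (minpoly F pb.gen)).det := by
  set Ω := AlgebraicClosure F
  have hint : IsIntegral F pb.gen := Algebra.IsIntegral.isIntegral _
  have hprod : (minpoly F pb.gen).map (algebraMap F Ω) = ∏ σ : E →ₐ[F] Ω, (X - C (σ pb.gen)) := by
    refine eq_of_monic_of_dvd_of_natDegree_le (monic_prod_of_monic _ _ fun σ _ => monic_X_sub_C _)
      ((minpoly.monic hint).map _) ?_ ?_
    · refine Finset.prod_dvd_of_coprime ?_ ?_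
      · exact fun σ _ τ _ h => pairwise_coprime_X_sub_C (s := fun σ : E →ₐ[F] Ω => σ pb.gen)
          (fun σ τ h => pb.algHom_ext h) h
      · intro σ _
        rw [dvd_iff_isRoot, IsRoot, eval_map_algebraMap, aeval_algHom_apply, minpoly.aeval,
          map_zero]
    · rw [natDegree_map, natDegree_prod_of_monic _ _ fun σ _ => monic_X_sub_C _]
      simp only [natDegree_X_sub_C, Finset.sum_const, Finset.card_univ, smul_eq_mul, mul_one]
      rw [AlgHom.card, pb.finrank, pb.natDegree_minpoly]
  apply (algebraMap F Ω).injective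
  rw [Algebra.norm_eq_prod_embeddings F Ω, RingHom.map_det]
  have h1 : (algebraMap F Ω).mapMatrix
      (aeval (!![0, m; 1, 0] : Matrix (Fin 2) (Fin 2) F) (minpoly F pb.gen)) =
      aeval (!![0, algebraMap F Ω m; 1, 0] : Matrix (Fin 2) (Fin 2) Ω)
        ((minpoly F pb.gen).map (algebraMap F Ω)) := by
    have h2 : (algebraMap F Ω).mapMatrix !![0, m; 1, 0] =
        (!![0, algebraMap F Ω m; 1, 0] : Matrix (Fin 2) (Fin 2) Ω) := by
      ext i j
      fin_cases i <;> fin_cases j <;> simp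
    rw [← h2, aeval_map_algebraMap]
    exact (aeval_algHom_apply (Algebra.ofId F Ω).mapMatrix _ _).symm
  rw [h1, hprod]
  let N : Matrix (Fin 2) (Fin 2) Ω := !![0, algebraMap F Ω m; 1, 0]
  let φ : Polynomial Ω →* Ω :=
    Matrix.detMonoidHom.comp (aeval (R := Ω) N).toRingHom.toMonoidHom
  refine Eq.trans ?_ (map_prod φ _ _).symm
  refine Finset.prod_congr rfl fun σ _ => ?_
  simp [φ, N, Matrix.det_fin_two, sq, Matrix.algebraMap_eq_diagonal]
  ring

theorem norm_sq_sub_eq_det_pow {F K : Type*} [Field F] [Field K] [Algebra F K]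
    [FiniteDimensional F K] [Algebra.IsSeparable F K] (α : K) (m : F) :
    Algebra.norm F (α ^ 2 - algebraMap F K m) =
      (aeval (!![0, m; 1, 0] : Matrix (Fin 2) (Fin 2) F) (minpoly F α)).det ^
        (Module.finrank F K / (minpoly F α).natDegree) := by
  have hint : IsIntegral F α := Algebra.IsIntegral.isIntegral _
  set E := IntermediateField.adjoin F {α}
  set pb := IntermediateField.adjoin.powerBasis hint with hpb
  have hgen : algebraMap E K pb.gen = α := by
    rw [hpb, IntermediateField.adjoin.powerBasis_gen]
    exact IntermediateField.AdjoinSimple.algebraMap_gen F α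
  have hmin : minpoly F pb.gen = minpoly F α := by
    have h3 := minpoly.algebraMap_eq (A := F) (algebraMap E K).injective pb.gen
    rwa [hgen, eq_comm] at h3
  have h1 : α ^ 2 - algebraMap F K m = algebraMap E K (pb.gen ^ 2 - algebraMap F E m) := by
    rw [map_sub, map_pow, hgen, ← IsScalarTower.algebraMap_apply]
  have h2 : Module.finrank E K = Module.finrank F K / (minpoly F α).natDegree := by
    have h3 := Module.finrank_mul_finrank F E K
    rw [← h3, IntermediateField.adjoin.finrank hint,
      Nat.mul_div_cancel_left _ (minpoly.natDegree_pos hint)]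
  rw [h1, ← Algebra.norm_norm (S := E), Algebra.norm_algebraMap, map_pow,
    norm_gen_sq_sub_eq_det pb m, hmin, h2]

theorem addChar_trace_mul_quadraticChar_norm {F K : Type*} [Field F] [Fintype F] [DecidableEq F]
    [Field K] [Algebra F K] [FiniteDimensional F K] (χ : AddChar F ℂ) (m : F) (α : K) :
    χ (Algebra.trace F K α) *
        (quadraticChar F (Algebra.norm F (α ^ 2 - algebraMap F K m)) : ℂ) =
      conicWeight χ m (minpoly F α) ^ (Module.finrank F K / (minpoly F α).natDegree) := by
  have hint : IsIntegral F α := Algebra.IsIntegral.isIntegral _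
  have h2 : Module.finrank (IntermediateField.adjoin F {α}) K =
      Module.finrank F K / (minpoly F α).natDegree := by
    have h3 := Module.finrank_mul_finrank F (IntermediateField.adjoin F {α}) K
    rw [← h3, IntermediateField.adjoin.finrank hint,
      Nat.mul_div_cancel_left _ (minpoly.natDegree_pos hint)]
  rw [norm_sq_sub_eq_det_pow, trace_eq_finrank_mul_minpoly_nextCoeff, h2, conicWeight, mul_pow,
    ← nsmul_eq_mul, AddChar.map_nsmul_eq_pow, map_pow, Int.cast_pow]

/-- A sum over a finite field of a function of the minimal polynomial, arranged by minimal
polynomials. -/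
theorem sum_minpoly_eq_sum_irreducibles {F K : Type*} [Field F] [Finite F] [Field K] [Fintype K]
    [Algebra F K] (G : F[X] → ℂ) :
    ∑ α : K, G (minpoly F α) =
      ∑ P ∈ irreduciblesOfDegreeDvd F (Module.finrank F K), (P.natDegree : ℂ) * G P := by
  classical
  cases nonempty_fintype F
  have hmaps : ∀ α ∈ (Finset.univ : Finset K),
      minpoly F α ∈ irreduciblesOfDegreeDvd F (Module.finrank F K) := by
    intro α _
    have hint : IsIntegral F α := Algebra.IsIntegral.isIntegral _
    exact mem_irreduciblesOfDegreeDvd.2 ⟨minpoly.monic hint, minpoly.irreducible hint,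
      minpoly.degree_dvd hint, Module.finrank_pos.ne'⟩
  rw [← Finset.sum_fiberwise_of_maps_to hmaps]
  refine Finset.sum_congr rfl fun P hP => ?_
  obtain ⟨hPm, hPi, hPd, -⟩ := mem_irreduciblesOfDegreeDvd.1 hP
  rw [Finset.sum_congr rfl fun α hα => by rw [(Finset.mem_filter.1 hα).2], Finset.sum_const,
    nsmul_eq_mul]
  congr 2
  have hcard : Nat.card F ^ Module.finrank F K = Fintype.card K := by
    rw [Nat.card_eq_fintype_card, ← Module.card_eq_pow_finrank]
  have hsplit : (P.map (algebraMap F K)).Splits := by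
    have hdvd := (hPi.natDegree_dvd_iff_dvd_X_pow_card_pow_sub_X).1 hPd
    rw [hcard] at hdvd
    have := FiniteField.isSplittingField_sub K F
    refine Splits.of_dvd (IsSplittingField.splits K (X ^ Fintype.card K - X : F[X])) ?_
      (map_dvd (mapRingHom (algebraMap F K)) hdvd)
    exact (Polynomial.map_ne_zero_iff (algebraMap F K).injective).2
      (FiniteField.X_pow_card_sub_X_ne_zero F Fintype.one_lt_card)
  rw [← card_rootSet_eq_natDegree (PerfectField.separable_of_irreducible hPi) hsplit,
    ← Set.toFinset_card]
  congr 1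
  ext α
  rw [Finset.mem_filter, Set.mem_toFinset, mem_rootSet]
  constructor
  · rintro ⟨-, rfl⟩
    exact ⟨hPi.ne_zero, minpoly.aeval F α⟩
  · rintro ⟨-, h⟩
    exact ⟨Finset.mem_univ _, (minpoly.eq_of_irreducible_of_monic hPi h hPm).symm⟩

theorem sum_addChar_trace_eq_sum_irreducibles {F K : Type*} [Field F] [Fintype F] [DecidableEq F]
    [Field K] [Fintype K] [Algebra F K] (χ : AddChar F ℂ) (m : F) :
    ∑ α : K, χ (Algebra.trace F K α) *
        (quadraticChar F (Algebra.norm F (α ^ 2 - algebraMap F K m)) : ℂ) =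
      ∑ P ∈ irreduciblesOfDegreeDvd F (Module.finrank F K),
        (P.natDegree : ℂ) * conicWeight χ m P ^ (Module.finrank F K / P.natDegree) := by
  simp only [addChar_trace_mul_quadraticChar_norm]
  exact sum_minpoly_eq_sum_irreducibles
    (fun P => conicWeight χ m P ^ (Module.finrank F K / P.natDegree))

/-- The quadratic character of an extension is the quadratic character of the norm. -/
theorem quadraticChar_norm {F K : Type*} [Field F] [Fintype F] [DecidableEq F]
    [Field K] [Fintype K] [DecidableEq K] [Algebra F K] (hF : ringChar F ≠ 2) (x : K) :
    quadraticChar F (Algebra.norm F x) = quadraticChar K x := by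
  have hK : ringChar K ≠ 2 := by
    rwa [← Algebra.ringChar_eq F K]
  refine (quadraticChar_isQuadratic F).eq_of_eq_coe (quadraticChar_isQuadratic K) hK ?_
  rw [quadraticChar_eq_pow_of_char_ne_two' hK]
  have h1 : ((quadraticChar F (Algebra.norm F x) : ℤ) : K) =
      algebraMap F K ((quadraticChar F (Algebra.norm F x) : ℤ) : F) := by simp
  rw [h1, quadraticChar_eq_pow_of_char_ne_two' hF, map_pow, FiniteField.algebraMap_norm_eq_pow,
    ← pow_mul, Nat.card_eq_fintype_card, Nat.card_eq_fintype_card]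
  congr 1
  have hq := FiniteField.odd_card_of_char_ne_two hF
  have hQ := FiniteField.odd_card_of_char_ne_two hK
  obtain ⟨c, hc⟩ : Fintype.card F - 1 ∣ Fintype.card K - 1 := by
    rw [Module.card_eq_pow_finrank (K := F) (V := K)]
    simpa using Nat.sub_dvd_pow_sub_pow (Fintype.card F) 1 (Module.finrank F K)
  have hq1 : 1 < Fintype.card F := Fintype.one_lt_card
  rw [hc, Nat.mul_div_cancel_left _ (by omega)]
  have e1 : Fintype.card F - 1 = 2 * (Fintype.card F / 2) := by omega
  have e2 : Fintype.card K - 1 = 2 * (Fintype.card K / 2) := by omega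
  rw [e1, e2] at hc
  have : 2 * (c * (Fintype.card F / 2)) = 2 * (Fintype.card K / 2) := by rw [hc]; ring
  omega

/-- The sums attached to the extensions of `F` are, up to sign, the power sums of the two inverse
zeros of the L-function `1 + S T + q T²`, where `S` is the sum over `F` itself. -/
theorem exists_sum_addChar_trace_eq_powerSum {F : Type*} [Field F] [Fintype F] [DecidableEq F]
    (hF : ringChar F ≠ 2) {χ : AddChar F ℂ} (hχ : χ ≠ 1) {m : F} (hm : m ≠ 0) :
    ∃ x y : ℂ, x + y = -∑ z : F, χ z * (quadraticChar F (z ^ 2 - m) : ℂ) ∧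
      ∀ (K : Type) [Field K] [Fintype K] [DecidableEq K] [Algebra F K],
        ∑ z : K, χ (Algebra.trace F K z) * (quadraticChar K (z ^ 2 - algebraMap F K m) : ℂ) =
          -(x ^ Module.finrank F K + y ^ Module.finrank F K) := by
  set S := ∑ z : F, χ z * (quadraticChar F (z ^ 2 - m) : ℂ) with hS
  obtain ⟨δ, hδ⟩ := IsAlgClosed.exists_pow_nat_eq (S ^ 2 - 4 * Fintype.card F) (n := 2) two_pos
  refine ⟨(-S + δ) / 2, (-S - δ) / 2, by ring, fun K _ _ _ _ => ?_⟩
  have h := powerSum_of_newton (sum_conicWeight_zero χ m) (sum_conicWeight_one χ m)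
    (sum_conicWeight_two hF hχ hm) (fun n hn => sum_conicWeight_eq_zero hχ m hn)
    (natCast_mul_sum_monicsOfDegree _ (conicWeight_one χ m)
      (fun f g hf hg => conicWeight_mul χ m hf hg))
    (x := (-S + δ) / 2) (y := (-S - δ) / 2) (by ring) (by linear_combination (-1 / 4) * hδ)
    (Module.finrank F K) Module.finrank_pos
  rw [← h, ← sum_addChar_trace_eq_sum_irreducibles]
  simp only [quadraticChar_norm hF]

end ExtensionSum

/-! ### The Weil bound for conic sums -/

/-- A sum over the values `w ^ q - w` on an extension field, detected by the additive characters
of the base field: these values are the elements of trace zero, each taken `q` times. -/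
theorem sum_pow_card_sub_self {F K : Type*} [Field F] [Fintype F] [Field K] [Fintype K]
    [Algebra F K] {χ : AddChar F ℂ} (hχ : χ ≠ 1) (G : K → ℂ) :
    ∑ w : K, G (w ^ Fintype.card F - w) =
      ∑ c : F, ∑ z : K, χ (c * Algebra.trace F K z) * G z := by
  classical
  set q := Fintype.card F with hq
  let φ : K →ₗ[F] K := (FiniteField.frobeniusAlgHom F K).toLinearMap - LinearMap.id
  have hφ : ∀ w, φ w = w ^ q - w := fun w => by simp [φ, hq]
  have hkercard : (Finset.univ.filter fun w : K => φ w = 0).card = q := by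
    apply le_antisymm
    · have hne := FiniteField.X_pow_card_sub_X_ne_zero K (Fintype.one_lt_card (α := F))
      calc _ ≤ (Polynomial.X ^ q - Polynomial.X : Polynomial K).roots.toFinset.card := by
            refine Finset.card_le_card fun w hw => ?_
            have hw := (Finset.mem_filter.1 hw).2
            rw [hφ] at hw
            rw [Multiset.mem_toFinset, Polynomial.mem_roots hne]
            simpa using hw
        _ ≤ _ := Multiset.toFinset_card_le _
        _ ≤ (Polynomial.X ^ q - Polynomial.X : Polynomial K).natDegree := Polynomial.card_roots' _
        _ = q := FiniteField.X_pow_card_sub_X_natDegree_eq K Fintype.one_lt_card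
    · rw [hq, ← Finset.card_univ,
        ← Finset.card_image_of_injective Finset.univ (algebraMap F K).injective]
      refine Finset.card_le_card fun w hw => ?_
      obtain ⟨a, -, rfl⟩ := Finset.mem_image.1 hw
      rw [Finset.mem_filter, hφ, ← map_pow, FiniteField.pow_card, sub_self]
      exact ⟨Finset.mem_univ _, rfl⟩
  have hker : Module.finrank F (LinearMap.ker φ) = 1 := by
    have h1 := Module.card_eq_pow_finrank (K := F) (V := LinearMap.ker φ)
    have h2 : Fintype.card (LinearMap.ker φ) = q := by
      rw [← hkercard, Fintype.card_subtype]
      simp only [LinearMap.mem_ker]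
    rw [h2] at h1
    exact Nat.pow_right_injective (Fintype.one_lt_card (α := F)) (h1.symm.trans (pow_one _).symm)
  have hrange : LinearMap.range φ = LinearMap.ker (Algebra.trace F K) := by
    refine Submodule.eq_of_le_of_finrank_eq ?_ ?_
    · rintro _ ⟨w, rfl⟩
      have h1 : Algebra.trace F K (w ^ q) = Algebra.trace F K w :=
        Algebra.trace_eq_of_algEquiv (FiniteField.frobeniusAlgEquivOfAlgebraic F K) w
      rw [LinearMap.mem_ker, hφ, map_sub, h1, sub_self]
    · have h1 := LinearMap.finrank_range_add_finrank_ker φ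
      have h2 := LinearMap.finrank_range_add_finrank_ker (Algebra.trace F K)
      rw [LinearMap.range_eq_top.2 (Algebra.trace_surjective F K), finrank_top,
        Module.finrank_self] at h2
      omega
  have hfiber : ∀ z : K, ((Finset.univ.filter fun w : K => φ w = z).card : ℂ) =
      if Algebra.trace F K z = 0 then (q : ℂ) else 0 := by
    intro z
    split_ifs with hz
    · have hz' : z ∈ LinearMap.range φ := by rw [hrange]; exact hz
      have := AddMonoidHom.card_fiber_eq_of_mem_range φ.toAddMonoidHom (x := z) (y := 0) hz'
        ⟨0, map_zero _⟩
      rw [← hkercard]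
      exact congrArg Nat.cast this
    · rw [Finset.filter_false_of_mem, Finset.card_empty, Nat.cast_zero]
      rintro w - rfl
      apply hz
      have : φ w ∈ LinearMap.ker (Algebra.trace F K) := by rw [← hrange]; exact ⟨w, rfl⟩
      exact this
  calc ∑ w : K, G (w ^ q - w) = ∑ w : K, G (φ w) := by simp only [hφ]
    _ = ∑ z : K, ∑ w : K with φ w = z, G (φ w) :=
        (Finset.sum_fiberwise _ _ _).symm
    _ = ∑ z : K, ((Finset.univ.filter fun w : K => φ w = z).card : ℂ) * G z := by
        refine Finset.sum_congr rfl fun z _ => ?_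
        rw [Finset.sum_congr rfl fun w hw => by rw [(Finset.mem_filter.1 hw).2],
          Finset.sum_const, nsmul_eq_mul]
    _ = ∑ z : K, (∑ c : F, χ (c * Algebra.trace F K z)) * G z := by
        refine Finset.sum_congr rfl fun z _ => ?_
        rw [hfiber, AddChar.sum_mulShift _ (AddChar.IsPrimitive.of_ne_one hχ)]
        split_ifs <;> simp [hq]
    _ = _ := by
        simp only [Finset.sum_mul]
        rw [Finset.sum_comm]

open Polynomial in
/-- Stepanov's bound for the curve `y² = (w ^ q - w)² - m`, over an extension with `s²` elements
of the field with `q` elements. -/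
theorem neg_le_sum_quadraticChar_pow_card_sub_self {F K : Type*} [Field F] [Fintype F] [Field K]
    [Fintype K] [DecidableEq K] [Algebra F K] (hK : ringChar K ≠ 2) {m : K} (hm : m ≠ 0) {s : ℕ}
    (hs : Fintype.card K = s ^ 2) (hodd : Odd s) (hlarge : 4 * Fintype.card F + 3 ≤ s) :
    -((8 * Fintype.card F + 4) * s : ℤ) ≤
      ∑ w : K, quadraticChar K ((w ^ Fintype.card F - w) ^ 2 - m) := by
  set q := Fintype.card F with hq
  have hq1 : 1 < q := Fintype.one_lt_card
  have h2 : (2 : K) ≠ 0 := Ring.two_ne_zero hK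
  have hqK : (q : K) = 0 := by
    rw [← map_natCast (algebraMap F K), hq, FiniteField.cast_card_eq_zero, map_zero]
  set f : K[X] := (X ^ q - X) ^ 2 - C m with hf
  have hfd : f.natDegree = 2 * q := by
    rw [hf, natDegree_sub_C, natDegree_pow, FiniteField.X_pow_card_sub_X_natDegree_eq K hq1]
  have heval : ∀ w : K, f.eval w = (w ^ q - w) ^ 2 - m := fun w => by simp [hf]
  have hsq : Squarefree f := by
    -- The derivative of `f` is `-2 (X ^ q - X)`, and `f` is the constant `-m` modulo `X ^ q - X`.
    refine Separable.squarefree ⟨C (-1 / m), C (-1 / (2 * m)) * (X ^ q - X), ?_⟩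
    have hC2 : (C 2 : K[X]) = 2 := map_ofNat C 2
    have hder : derivative f = -2 * (X ^ q - X) := by
      simp [hf, derivative_pow, hqK, hC2]
    have e1 : C (-1 / m) * C m = (-1 : K[X]) := by
      rw [← C_mul, div_mul_cancel₀ _ hm, C_neg, C_1]
    have e2 : C (-1 / (2 * m)) * (-2 : K[X]) = -C (-1 / m) := by
      rw [← C_neg, show (-2 : K[X]) = C (-2) by rw [C_neg, hC2], ← C_mul]
      congr 1
      field_simp
    rw [hder, hf]
    linear_combination -e1 + (X ^ q - X) ^ 2 * e2
  have h0 : f.eval 0 ≠ 0 := by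
    rw [heval]
    simpa [hq] using hm
  have hodd' := FiniteField.odd_card_of_char_ne_two hK
  have hbound := two_mul_card_eval_pow_eq_le hsq (by omega) h0 (M := Fintype.card K / 2)
    (by omega) hs hodd (by omega) (ε := -1) (by simp)
  rw [hfd] at hbound
  set A := Finset.univ.filter fun w : K => f.eval w ^ (Fintype.card K / 2) = -1 with hA
  set Z := Finset.univ.filter fun w : K => f.eval w = 0 with hZ
  have hf0 : f ≠ 0 := by
    intro h
    rw [h] at hfd
    simp at hfd
    omega
  have hZcard : Z.card ≤ 2 * q := by
    rw [← hfd]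
    calc Z.card ≤ f.roots.toFinset.card := by
          refine Finset.card_le_card fun w hw => ?_
          rw [Multiset.mem_toFinset, mem_roots hf0]
          exact (Finset.mem_filter.1 hw).2
      _ ≤ _ := Multiset.toFinset_card_le _
      _ ≤ _ := card_roots' _
  have hpoint : ∀ w : K, 1 - (if w ∈ Z then 1 else 0) - (if w ∈ A then 2 else 0) ≤
      quadraticChar K ((w ^ q - w) ^ 2 - m) := by
    intro w
    rw [← heval w]
    by_cases hw : f.eval w = 0
    · have : w ∈ Z := by simp [hZ, hw]
      rw [hw, quadraticChar_zero, if_pos this]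
      split_ifs <;> norm_num
    · rcases quadraticChar_dichotomy hw with h | h
      · rw [h]
        split_ifs <;> norm_num
      · have hwA : w ∈ A := by
          rw [hA, Finset.mem_filter, ← quadraticChar_eq_pow_of_char_ne_two' hK, h]
          simp
        rw [h, if_pos hwA]
        split_ifs <;> norm_num
  have hsum := Finset.sum_le_sum fun w (_ : w ∈ (Finset.univ : Finset K)) => hpoint w
  refine le_trans ?_ hsum
  rw [Finset.sum_sub_distrib, Finset.sum_sub_distrib, Finset.sum_ite_mem, Finset.sum_ite_mem]
  simp only [Finset.univ_inter, Finset.sum_const, Finset.card_univ, hs, nsmul_eq_mul, mul_one]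
  zify at hbound hZcard hlarge
  push_cast
  nlinarith

/-- **Weil's bound** for the sums `∑ χ(z) η(z² - m)`. -/
theorem norm_sum_addChar_mul_quadraticChar_le {F : Type*} [Field F] [Fintype F] [DecidableEq F]
    (hF : ringChar F ≠ 2) {χ : AddChar F ℂ} (hχ : χ ≠ 1) {m : F} (hm : m ≠ 0) :
    ‖∑ z : F, χ z * (quadraticChar F (z ^ 2 - m) : ℂ)‖ ≤ 2 * Real.sqrt (Fintype.card F) := by
  set q := Fintype.card F with hq
  have hq1 : 1 < q := Fintype.one_lt_card
  have hq0 : (0 : ℝ) < q := by exact_mod_cast hq1.trans' one_pos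
  have hqodd : Odd q := Nat.odd_iff.2 (FiniteField.odd_card_of_char_ne_two hF)
  have hq3 : 3 ≤ q := by
    obtain ⟨a, ha⟩ := hqodd
    omega
  have hprim := AddChar.IsPrimitive.of_ne_one hχ
  have hex : ∀ c : {c : F // c ≠ 0}, ∃ xy : ℂ × ℂ,
      xy.1 + xy.2 = -∑ z : F, χ.mulShift c z * (quadraticChar F (z ^ 2 - m) : ℂ) ∧
      ∀ (K : Type) [Field K] [Fintype K] [DecidableEq K] [Algebra F K],
        ∑ z : K, χ.mulShift c (Algebra.trace F K z) *
            (quadraticChar K (z ^ 2 - algebraMap F K m) : ℂ) =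
          -(xy.1 ^ Module.finrank F K + xy.2 ^ Module.finrank F K) := by
    intro c
    obtain ⟨x, y, h1, h2⟩ := exists_sum_addChar_trace_eq_powerSum hF (hprim c.2) hm
    exact ⟨(x, y), h1, h2⟩
  choose ω hω1 hω2 using hex
  let z : {c : F // c ≠ 0} × Bool → ℂ := fun i =>
    (if i.2 then (ω i.1).1 else (ω i.1).2) ^ 2 / q
  have hz : ∀ k, 3 ≤ k → (∑ i, z i ^ k).re ≤ 8 * q + 4 := by
    intro k hk
    obtain ⟨p, hp⟩ := CharP.exists F
    have : Fact p.Prime := ⟨CharP.char_is_prime F p⟩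
    have : NeZero (2 * k) := ⟨by omega⟩
    -- An even degree makes the square root `q ^ k` of the order of `K` an integer.
    let K := FiniteField.Extension F p (2 * k)
    let : Fintype K := Fintype.ofFinite K
    let : DecidableEq K := Classical.decEq K
    have hrank : Module.finrank F K = 2 * k := FiniteField.finrank_extension F p (2 * k)
    have hK : ringChar K ≠ 2 := by rwa [← Algebra.ringChar_eq F K]
    have hmK : algebraMap F K m ≠ 0 := by simpa using hm
    have hcard : Fintype.card K = (q ^ k) ^ 2 := by
      rw [Module.card_eq_pow_finrank (K := F), hrank, mul_comm 2 k, pow_mul]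
    have hlarge : 4 * q + 3 ≤ q ^ k := by
      calc 4 * q + 3 ≤ q ^ 3 := by nlinarith [Nat.mul_le_mul hq3 hq3]
        _ ≤ q ^ k := Nat.pow_le_pow_right (by omega) hk
    have hstep := neg_le_sum_quadraticChar_pow_card_sub_self (F := F) hK hmK hcard hqodd.pow hlarge
    have hsplit := sum_pow_card_sub_self (K := K) hχ
      (fun z => (quadraticChar K (z ^ 2 - algebraMap F K m) : ℂ))
    rw [← Fintype.sum_subtype_add_sum_subtype (fun c : F => c ≠ 0)] at hsplit
    have hzero : ∑ c : {c : F // ¬ c ≠ 0}, ∑ z : K, χ (c * Algebra.trace F K z) *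
        (quadraticChar K (z ^ 2 - algebraMap F K m) : ℂ) = -1 := by
      have huniq : ∀ c : {c : F // ¬ c ≠ 0}, (c : F) = 0 := fun c => not_not.1 c.2
      simp only [huniq, zero_mul, AddChar.map_zero_eq_one, one_mul, ← Int.cast_sum,
        sum_quadraticChar_sq_sub hK hmK]
      simp
    have hmain : ∑ c : {c : F // c ≠ 0}, ∑ z : K, χ (c * Algebra.trace F K z) *
        (quadraticChar K (z ^ 2 - algebraMap F K m) : ℂ) = -((q : ℂ) ^ k * ∑ i, z i ^ k) := by
      rw [Fintype.sum_prod_type, Finset.mul_sum, ← Finset.sum_neg_distrib]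
      refine Finset.sum_congr rfl fun c _ => ?_
      have h1 := hω2 c K
      simp only [AddChar.mulShift_apply] at h1
      have hqC : (q : ℂ) ≠ 0 := by exact_mod_cast hq0.ne'
      rw [h1, hrank, Fintype.sum_bool]
      simp only [z, if_true, div_pow, ← pow_mul]
      field_simp
      simp
    rw [hzero, hmain, ← Int.cast_sum] at hsplit
    have hre := congrArg Complex.re hsplit
    rw [Complex.intCast_re, Complex.add_re, Complex.neg_re, ← Complex.ofReal_natCast,
      ← Complex.ofReal_pow, Complex.re_ofReal_mul, Complex.neg_re, Complex.one_re] at hre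
    have hstep' : -((8 * q + 4) * q ^ k : ℝ) ≤
        ((∑ w : K, quadraticChar K ((w ^ q - w) ^ 2 - algebraMap F K m) : ℤ) : ℝ) := by
      exact_mod_cast hstep
    rw [hre] at hstep'
    have hqk : (0 : ℝ) < q ^ k := by positivity
    refine le_of_mul_le_mul_left ?_ hqk
    linarith
  -- The character `χ` itself is the multiplicative shift by `c = 1`.
  have hnorm : ∀ i, ‖z i‖ ≤ 1 := norm_le_one_of_re_powerSum_le z _ 3 hz
  have hsqrt : ∀ x : ℂ, ‖x ^ 2 / q‖ ≤ 1 → ‖x‖ ≤ Real.sqrt q := by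
    intro x hx
    rw [norm_div, norm_pow, Complex.norm_natCast, div_le_one hq0] at hx
    exact Real.le_sqrt_of_sq_le hx
  have hx := hsqrt _ (hnorm (⟨1, one_ne_zero⟩, true))
  have hy := hsqrt _ (hnorm (⟨1, one_ne_zero⟩, false))
  have hS := hω1 ⟨1, one_ne_zero⟩
  simp only [AddChar.mulShift_one] at hS
  rw [← norm_neg, ← hS]
  refine (norm_add_le _ _).trans ?_
  simp only [if_true, Bool.false_eq_true, if_false] at hx hy
  linarith

/-! ### Sums over the circle `x² + y² = 1` -/

/-- The exponential sum `∑ χ(u x + v y)` over the points of the circle `x² + y² = 1`. -/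
noncomputable def circleSum {F : Type*} [Field F] [Fintype F] [DecidableEq F] (χ : AddChar F ℂ)
    (u v : F) : ℂ :=
  ∑ p : F × F with p.1 ^ 2 + p.2 ^ 2 = 1, χ (u * p.1 + v * p.2)

section CircleSum

variable {F : Type*} [Field F] [Fintype F] [DecidableEq F]

theorem sum_circle_fst (hF : ringChar F ≠ 2) (G : F → ℂ) (m : F) :
    ∑ p : F × F with p.1 ^ 2 + p.2 ^ 2 = m, G p.1 =
      ∑ z : F, G z +
        (quadraticChar F (-1) : ℂ) * ∑ z : F, G z * (quadraticChar F (z ^ 2 - m) : ℂ) := by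
  rw [Finset.sum_filter, Fintype.sum_prod_type, Finset.mul_sum, ← Finset.sum_add_distrib]
  refine Finset.sum_congr rfl fun z _ => ?_
  have h1 : ((Finset.univ.filter fun w : F => z ^ 2 + w ^ 2 = m).card : ℤ) =
      quadraticChar F (m - z ^ 2) + 1 := by
    rw [← quadraticChar_card_sqrts hF]
    congr 2
    ext w
    simp [eq_sub_iff_add_eq, add_comm]
  have h2 : quadraticChar F (m - z ^ 2) = quadraticChar F (-1) * quadraticChar F (z ^ 2 - m) := by
    rw [← map_mul]
    congr 1
    ring
  rw [h2] at h1
  have h3 := congrArg (Int.cast : ℤ → ℂ) h1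
  push_cast at h3
  dsimp only
  rw [← Finset.sum_filter, Finset.sum_const, nsmul_eq_mul, h3]
  ring

theorem circleSum_eq_of_sq_add_sq_ne_zero (χ : AddChar F ℂ) {u v : F} (h : u ^ 2 + v ^ 2 ≠ 0) :
    circleSum χ u v = ∑ p : F × F with p.1 ^ 2 + p.2 ^ 2 = u ^ 2 + v ^ 2, χ p.1 := by
  refine Finset.sum_bij' (fun p _ => (u * p.1 + v * p.2, u * p.2 - v * p.1))
    (fun p _ => ((u * p.1 - v * p.2) / (u ^ 2 + v ^ 2), (v * p.1 + u * p.2) / (u ^ 2 + v ^ 2)))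
    ?_ ?_ ?_ ?_ ?_
  · rintro ⟨x, y⟩ hp
    simp only [Finset.mem_filter, Finset.mem_univ, true_and] at hp ⊢
    linear_combination (u ^ 2 + v ^ 2) * hp
  · rintro ⟨x, y⟩ hp
    simp only [Finset.mem_filter, Finset.mem_univ, true_and] at hp ⊢
    field_simp
    linear_combination (u ^ 2 + v ^ 2) * hp
  · rintro ⟨x, y⟩ hp
    refine Prod.ext ?_ ?_
    · field_simp
      ring
    · field_simp
      ring
  · rintro ⟨x, y⟩ hp
    refine Prod.ext ?_ ?_
    · field_simp
      ring
    · field_simp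
      ring
  · rintro ⟨x, y⟩ hp
    rfl

/-- For an isotropic frequency the circle becomes the hyperbola `t t' = 1`, and the sum is a
complete sum without its term at `0`. -/
theorem circleSum_of_sq_add_sq_eq_zero (hF : ringChar F ≠ 2) {χ : AddChar F ℂ} (hχ : χ ≠ 1)
    {u v : F} (h0 : u ≠ 0) (h : u ^ 2 + v ^ 2 = 0) : circleSum χ u v = -1 := by
  have h2 : (2 : F) ≠ 0 := Ring.two_ne_zero hF
  have hv : v ≠ 0 := by
    rintro rfl
    simp [h0] at h
  have hbij : circleSum χ u v = ∑ t ∈ Finset.univ.erase (0 : F), χ t := by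
    refine Finset.sum_bij' (fun p _ => u * p.1 + v * p.2)
      (fun t _ => ((t / u + u / t) / 2, (t / v + v / t) / 2)) ?_ ?_ ?_ ?_ ?_
    · rintro ⟨x, y⟩ hp
      simp only [Finset.mem_filter, Finset.mem_univ, true_and, Finset.mem_erase, and_true] at hp ⊢
      intro h3
      have : u ^ 2 = 0 := by
        linear_combination (u * x - v * y) * h3 - u ^ 2 * hp + y ^ 2 * h
      exact h0 (pow_eq_zero_iff two_ne_zero |>.1 this)
    · intro t ht
      have ht : t ≠ 0 := Finset.ne_of_mem_erase ht
      simp only [Finset.mem_filter, Finset.mem_univ, true_and]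
      have h3 : (u ^ 2)⁻¹ + (v ^ 2)⁻¹ = 0 := by
        field_simp
        linear_combination h
      field_simp at h3 ⊢
      linear_combination (t ^ 4 + u ^ 2 * v ^ 2) * h
    · rintro ⟨x, y⟩ hp
      simp only [Finset.mem_filter, Finset.mem_univ, true_and] at hp
      have h3 : (u * x + v * y) * (u * x - v * y) = u ^ 2 := by
        linear_combination u ^ 2 * hp - y ^ 2 * h
      have h4 : u * x + v * y ≠ 0 := left_ne_zero_of_mul (h3.symm ▸ pow_ne_zero 2 h0)
      have h5 : u / (u * x + v * y) = (u * x - v * y) / u := by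
        rw [div_eq_div_iff h4 h0]
        linear_combination -h3
      have h6 : v / (u * x + v * y) = -(u * x - v * y) / v := by
        rw [div_eq_div_iff h4 hv]
        linear_combination h3 + h
      rw [Prod.mk.injEq, h5, h6]
      constructor
      · field_simp
        ring
      · field_simp
        ring
    · intro t ht
      have ht : t ≠ 0 := Finset.ne_of_mem_erase ht
      field_simp
      linear_combination h
    · intro p _
      rfl
  rw [hbij, ← sub_eq_zero, sub_neg_eq_add]
  have h3 := Finset.sum_erase_add Finset.univ (fun t => χ t) (Finset.mem_univ (0 : F))
  rw [AddChar.sum_eq_zero_of_ne_one hχ, AddChar.map_zero_eq_one] at h3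
  exact h3

theorem norm_circleSum_le (hF : ringChar F ≠ 2) {χ : AddChar F ℂ} (hχ : χ ≠ 1)
    {u v : F} (h : ¬ (u = 0 ∧ v = 0)) :
    ‖circleSum χ u v‖ ≤ 2 * Real.sqrt (Fintype.card F) := by
  by_cases hm : u ^ 2 + v ^ 2 = 0
  · have hu : u ≠ 0 := by
      rintro rfl
      exact h ⟨rfl, by simpa using hm⟩
    rw [circleSum_of_sq_add_sq_eq_zero hF hχ hu hm, norm_neg, norm_one]
    have h1 : (1 : ℝ) ≤ Real.sqrt (Fintype.card F) :=
      Real.one_le_sqrt.2 (by exact_mod_cast Fintype.card_pos)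
    linarith
  · rw [circleSum_eq_of_sq_add_sq_ne_zero χ hm, sum_circle_fst hF,
      AddChar.sum_eq_zero_of_ne_one hχ, zero_add, norm_mul]
    have h1 : ‖(quadraticChar F (-1) : ℂ)‖ = 1 := by
      rcases quadraticChar_dichotomy (F := F) (a := -1) (by simp) with h | h <;> simp [h]
    rw [h1, one_mul]
    exact norm_sum_addChar_mul_quadraticChar_le hF hχ hm

theorem card_circle (hF : ringChar F ≠ 2) :
    ((Finset.univ.filter fun p : F × F => p.1 ^ 2 + p.2 ^ 2 = 1).card : ℤ) =
      Fintype.card F - quadraticChar F (-1) := by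
  have h := sum_circle_fst hF (fun _ => 1) 1
  simp only [Finset.sum_const, nsmul_eq_mul, mul_one, one_mul, Finset.card_univ, ← Int.cast_sum,
    sum_quadraticChar_sq_sub hF one_ne_zero] at h
  have h' : ((Finset.univ.filter fun p : F × F => p.1 ^ 2 + p.2 ^ 2 = 1).card : ℂ) =
      ((Fintype.card F - quadraticChar F (-1) : ℤ) : ℂ) := by
    rw [h]
    push_cast
    ring
  exact_mod_cast h'

end CircleSum

/-! ### The orthogonal group of the plane -/

section Orthogonal

open scoped Matrix

variable {F : Type*} [Field F] [Fintype F]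

open Classical in
theorem sum_specialOrthogonalGroup_fin_two {M : Type*} [AddCommMonoid M]
    (G : Matrix (Fin 2) (Fin 2) F → M) :
    ∑ g : Matrix (Fin 2) (Fin 2) F with g ∈ Matrix.specialOrthogonalGroup (Fin 2) F, G g =
      ∑ p : F × F with p.1 ^ 2 + p.2 ^ 2 = 1, G !![p.1, -p.2; p.2, p.1] := by
  refine Finset.sum_bij' (fun g _ => (g 0 0, g 1 0)) (fun p _ => !![p.1, -p.2; p.2, p.1])
    ?_ ?_ ?_ ?_ ?_
  · intro g hg
    simp only [Finset.mem_filter, Finset.mem_univ, true_and,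
      Matrix.mem_specialOrthogonalGroup_fin_two_iff] at hg ⊢
    rw [← hg.2.2, hg.2.1, neg_sq]
  · intro p hp
    simpa using hp
  · intro g hg
    simp only [Finset.mem_filter, Finset.mem_univ, true_and,
      Matrix.mem_specialOrthogonalGroup_fin_two_iff] at hg
    ext i j
    fin_cases i <;> fin_cases j <;> simp [hg.1, hg.2.1]
  · intro p hp
    simp
  · intro g hg
    simp only [Finset.mem_filter, Finset.mem_univ, true_and,
      Matrix.mem_specialOrthogonalGroup_fin_two_iff] at hg
    congr 1
    ext i j
    fin_cases i <;> fin_cases j <;> simp [hg.1, hg.2.1]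

theorem natCard_specialOrthogonalGroup_fin_two [DecidableEq F] :
    Nat.card (Matrix.specialOrthogonalGroup (Fin 2) F) =
      (Finset.univ.filter fun p : F × F => p.1 ^ 2 + p.2 ^ 2 = 1).card := by
  classical
  have h := sum_specialOrthogonalGroup_fin_two (F := F) (fun _ => 1)
  rw [Finset.sum_const, Finset.sum_const, smul_eq_mul, smul_eq_mul, mul_one, mul_one] at h
  rw [Nat.card_eq_fintype_card, Fintype.card_subtype]
  convert h

theorem orthogonal_mul_reflection_iff {F : Type*} [Field F] (hF : ringChar F ≠ 2)
    (g : Matrix (Fin 2) (Fin 2) F) :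
    g * !![1, 0; 0, -1] ∈ Matrix.specialOrthogonalGroup (Fin 2) F ↔
      g ∈ Matrix.orthogonalGroup (Fin 2) F ∧ ¬ g.det = 1 := by
  have hD : (!![1, 0; 0, -1] : Matrix (Fin 2) (Fin 2) F) * !![1, 0; 0, -1]ᵀ = 1 := by
    ext i j
    fin_cases i <;> fin_cases j <;> simp [Matrix.mul_apply]
  have hdet : (g * !![1, 0; 0, -1]).det = -g.det := by
    rw [Matrix.det_mul, Matrix.det_fin_two_of]
    ring
  rw [Matrix.mem_specialOrthogonalGroup_iff, hdet, Matrix.mem_orthogonalGroup_iff (Fin 2) F,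
    Matrix.mem_orthogonalGroup_iff (Fin 2) F, Matrix.transpose_mul, Matrix.mul_assoc,
    ← Matrix.mul_assoc !![1, 0; 0, -1], hD, Matrix.one_mul]
  refine and_congr_right fun h => ?_
  have h1 : g.det * g.det = 1 := by
    have := congrArg Matrix.det h
    rwa [Matrix.det_mul, Matrix.det_transpose, Matrix.det_one] at this
  have h2 : (-1 : F) ≠ 1 := Ring.neg_one_ne_one_of_char_ne_two hF
  rcases mul_self_eq_one_iff.1 h1 with h3 | h3
  · simp [h3, h2]
  · simp [h3, h2]

/-- Rotations and reflections contribute one circle sum each. -/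
theorem orthoEigenvalue_eq_circleSum_add [DecidableEq F] (hF : ringChar F ≠ 2) (χ : AddChar F ℂ)
    (A : Matrix (Fin 2) (Fin 2) F) :
    orthoEigenvalue χ A = circleSum χ (A 0 0 + A 1 1) (A 0 1 - A 1 0) +
      circleSum χ (A 0 0 - A 1 1) (A 0 1 + A 1 0) := by
  classical
  have hrot : ∀ B : Matrix (Fin 2) (Fin 2) F,
      ∑ g : Matrix (Fin 2) (Fin 2) F with g ∈ Matrix.specialOrthogonalGroup (Fin 2) F,
        matChar χ B g = circleSum χ (B 0 0 + B 1 1) (B 0 1 - B 1 0) := by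
    intro B
    rw [sum_specialOrthogonalGroup_fin_two]
    unfold circleSum
    refine Finset.sum_congr (by congr) fun p _ => ?_
    simp only [matChar, Matrix.trace_fin_two, Matrix.mul_apply, Fin.sum_univ_two]
    congr 1
    simp
    ring
  have hDD : (!![1, 0; 0, -1] : Matrix (Fin 2) (Fin 2) F) * !![1, 0; 0, -1] = 1 := by
    ext i j
    fin_cases i <;> fin_cases j <;> simp
  set B : Matrix (Fin 2) (Fin 2) F := !![1, 0; 0, -1] * A with hB
  have hrefl := hrot B
  rw [orthoEigenvalue, ← Finset.sum_filter_add_sum_filter_not _ (fun g => g.det = 1),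
    Finset.filter_filter, Finset.filter_filter]
  congr 1
  · rw [← hrot A]
    simp only [Matrix.mem_specialOrthogonalGroup_iff]
  · have e : circleSum χ (A 0 0 - A 1 1) (A 0 1 + A 1 0) =
        circleSum χ (B 0 0 + B 1 1) (B 0 1 - B 1 0) := by
      simp only [B, Matrix.mul_apply, Fin.sum_univ_two]
      simp [sub_eq_add_neg]
    rw [e, ← hrefl]
    refine Finset.sum_bij' (fun g _ => g * !![1, 0; 0, -1]) (fun g _ => g * !![1, 0; 0, -1])
      ?_ ?_ ?_ ?_ ?_
    · intro g hg
      simpa [orthogonal_mul_reflection_iff hF] using hg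
    · intro g hg
      rw [Finset.mem_filter, ← orthogonal_mul_reflection_iff hF, Matrix.mul_assoc, hDD,
        Matrix.mul_one]
      exact ⟨Finset.mem_univ _, (Finset.mem_filter.1 hg).2⟩
    · intro g _
      rw [Matrix.mul_assoc, hDD, Matrix.mul_one]
    · intro g _
      rw [Matrix.mul_assoc, hDD, Matrix.mul_one]
    · intro g _
      have h1 : !![1, 0; 0, -1] * A * (g * !![1, 0; 0, -1]) =
          !![1, 0; 0, -1] * (A * g * !![1, 0; 0, -1]) := by simp only [Matrix.mul_assoc]
      rw [matChar, matChar, hB, h1, Matrix.trace_mul_comm !![1, 0; 0, -1], Matrix.mul_assoc, hDD,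
        Matrix.mul_one]

/-! ### Dependence of the eigenvalue on the Gram matrix -/

/-- The substitution `g ↦ g Q` permutes the terms of the sum, by cyclicity of the trace. -/
theorem orthoEigenvalue_mul_left (χ : AddChar F ℂ) {Q : Matrix (Fin 2) (Fin 2) F}
    (hQ : Q ∈ Matrix.orthogonalGroup (Fin 2) F) (A : Matrix (Fin 2) (Fin 2) F) :
    orthoEigenvalue χ (Q * A) = orthoEigenvalue χ A := by
  classical
  have h1 := (Matrix.mem_orthogonalGroup_iff _ _).1 hQ
  have h2 := (Matrix.mem_orthogonalGroup_iff' _ _).1 hQ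
  have hQ' : Qᵀ ∈ Matrix.orthogonalGroup (Fin 2) F := by
    rw [Matrix.mem_orthogonalGroup_iff (Fin 2) F, Matrix.transpose_transpose, h2]
  refine Finset.sum_bij' (fun g _ => g * Q) (fun g _ => g * Qᵀ) ?_ ?_ ?_ ?_ ?_
  · intro g hg
    simp only [Finset.mem_filter, Finset.mem_univ, true_and] at hg ⊢
    exact mul_mem hg hQ
  · intro g hg
    simp only [Finset.mem_filter, Finset.mem_univ, true_and] at hg ⊢
    exact mul_mem hg hQ'
  · intro g _
    rw [Matrix.mul_assoc, h1, Matrix.mul_one]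
  · intro g _
    rw [Matrix.mul_assoc, h2, Matrix.mul_one]
  · intro g _
    rw [matChar, matChar, Matrix.mul_assoc, Matrix.trace_mul_comm, Matrix.mul_assoc]

theorem orthoEigenvalue_mul_right (χ : AddChar F ℂ) {Q : Matrix (Fin 2) (Fin 2) F}
    (hQ : Q ∈ Matrix.orthogonalGroup (Fin 2) F) (A : Matrix (Fin 2) (Fin 2) F) :
    orthoEigenvalue χ (A * Q) = orthoEigenvalue χ A := by
  classical
  have h1 := (Matrix.mem_orthogonalGroup_iff _ _).1 hQ
  have h2 := (Matrix.mem_orthogonalGroup_iff' _ _).1 hQ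
  have hQ' : Qᵀ ∈ Matrix.orthogonalGroup (Fin 2) F := by
    rw [Matrix.mem_orthogonalGroup_iff (Fin 2) F, Matrix.transpose_transpose, h2]
  refine Finset.sum_bij' (fun g _ => Q * g) (fun g _ => Qᵀ * g) ?_ ?_ ?_ ?_ ?_
  · intro g hg
    simp only [Finset.mem_filter, Finset.mem_univ, true_and] at hg ⊢
    exact mul_mem hQ hg
  · intro g hg
    simp only [Finset.mem_filter, Finset.mem_univ, true_and] at hg ⊢
    exact mul_mem hQ' hg
  · intro g _
    rw [← Matrix.mul_assoc, h2, Matrix.one_mul]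
  · intro g _
    rw [← Matrix.mul_assoc, h1, Matrix.one_mul]
  · intro g _
    rw [matChar, matChar, Matrix.mul_assoc]

theorem transpose_mul_self_apply {F : Type*} [Field F] (A : Matrix (Fin 2) (Fin 2) F)
    (i j : Fin 2) :
    (Aᵀ * A) i j = colDot A i j := by
  simp [colDot, Matrix.mul_apply, dotProduct]

/-- Invertible matrices with the same Gram matrix differ by an orthogonal factor on the left. -/
theorem orthoEigenvalue_eq_of_colDot_eq (χ : AddChar F ℂ) {A B : GL (Fin 2) F}
    (h : ∀ i j, colDot A.val i j = colDot B.val i j) :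
    orthoEigenvalue χ A.val = orthoEigenvalue χ B.val := by
  have hgram : A.valᵀ * A.val = B.valᵀ * B.val := by
    ext i j
    rw [transpose_mul_self_apply, transpose_mul_self_apply, h]
  have hQ : A.val * B⁻¹.val ∈ Matrix.orthogonalGroup (Fin 2) F := by
    have hB : B.val * B⁻¹.val = 1 := B.mul_inv
    rw [Matrix.mem_orthogonalGroup_iff' (Fin 2) F, Matrix.transpose_mul, Matrix.mul_assoc,
      ← Matrix.mul_assoc _ A.val, hgram, Matrix.mul_assoc, hB, Matrix.mul_one,
      ← Matrix.transpose_mul, hB, Matrix.transpose_one]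
  have hA : A.val = (A.val * B⁻¹.val) * B.val := by
    rw [Matrix.mul_assoc, show B⁻¹.val * B.val = 1 from B.inv_mul, Matrix.mul_one]
  rw [hA, orthoEigenvalue_mul_left χ hQ]

/-- Exchanging the columns of a matrix is multiplication by an orthogonal matrix. -/
theorem exists_orthoEigenvalue_eq_colDot_swap (χ : AddChar F ℂ) (A : GL (Fin 2) F) :
    ∃ B : GL (Fin 2) F, orthoEigenvalue χ B.val = orthoEigenvalue χ A.val ∧
      colDot B.val 0 0 = colDot A.val 1 1 ∧ colDot B.val 1 1 = colDot A.val 0 0 ∧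
      colDot B.val 0 1 = colDot A.val 0 1 := by
  have hPP : (!![0, 1; 1, 0] : Matrix (Fin 2) (Fin 2) F) * !![0, 1; 1, 0] = 1 := by
    ext i j
    fin_cases i <;> fin_cases j <;> simp
  have hP : (!![0, 1; 1, 0] : Matrix (Fin 2) (Fin 2) F) ∈ Matrix.orthogonalGroup (Fin 2) F := by
    rw [Matrix.mem_orthogonalGroup_iff (Fin 2) F]
    rw [← hPP]
    congr 1
    ext i j
    fin_cases i <;> fin_cases j <;> simp
  refine ⟨A * ⟨!![0, 1; 1, 0], !![0, 1; 1, 0], hPP, hPP⟩, ?_, ?_, ?_, ?_⟩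
  · exact orthoEigenvalue_mul_right χ hP A.val
  all_goals
    simp [colDot, dotProduct, Fin.sum_univ_two, Matrix.mul_apply]
  ring

end Orthogonal

/-! ### Eigenvectors and bounds -/

/-- The characters `X ↦ χ (Tr (A X))` are eigenvectors of the Cayley digraph. -/
theorem hasEigenvector_matChar {F : Type*} [Field F] [Fintype F] (χ : AddChar F ℂ)
    (A : Matrix (Fin 2) (Fin 2) F) :
    Module.End.HasEigenvector
      (Matrix.mulVecLin (digraphAdjMatrix
        (matCayleyDigraph (Matrix.orthogonalGroup (Fin 2) F : Set _))))
      (orthoEigenvalue χ A) (matChar χ A) := by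
  classical
  rw [Module.End.hasEigenvector_iff, Module.End.mem_eigenspace_iff]
  constructor
  · funext X
    rw [Matrix.mulVecLin_apply, Pi.smul_apply, smul_eq_mul, Matrix.mulVec, dotProduct,
      ← Equiv.sum_comp (Equiv.addLeft X), orthoEigenvalue, Finset.sum_filter, Finset.sum_mul]
    refine Finset.sum_congr rfl fun g _ => ?_
    have h1 : matChar χ A (X + g) = matChar χ A g * matChar χ A X := by
      rw [matChar, Matrix.mul_add, Matrix.trace_add, AddChar.map_add_eq_mul, mul_comm, matChar,
        matChar]
    simp only [digraphAdjMatrix, matCayleyDigraph, Matrix.of_apply, Equiv.coe_addLeft,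
      add_sub_cancel_left, h1, SetLike.mem_coe]
    split_ifs <;> simp
  · intro h
    have := congrFun h 0
    simp [matChar] at this

/-- The degenerate case: `A` is a scalar multiple of an orthogonal matrix, and one of its two
circle sums has frequency zero. -/
theorem eq_or_eq_neg_of_colDot_eq {F : Type*} [Field F] (A : GL (Fin 2) F)
    (h1 : colDot A.val 0 0 = colDot A.val 1 1) (h2 : colDot A.val 0 0 ≠ 0)
    (h3 : colDot A.val 0 1 = 0) :
    (A.val 0 0 + A.val 1 1 = 0 ∧ A.val 0 1 - A.val 1 0 = 0) ∨
      (A.val 0 0 - A.val 1 1 = 0 ∧ A.val 0 1 + A.val 1 0 = 0) := by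
  simp only [colDot, dotProduct, Fin.sum_univ_two, Matrix.col_apply] at h1 h2 h3
  generalize A.val 0 0 = a at *
  generalize A.val 0 1 = b at *
  generalize A.val 1 0 = c at *
  generalize A.val 1 1 = d at *
  have h4 : (a * d - b * c - (a * a + c * c)) * (a * d - b * c + (a * a + c * c)) = 0 := by
    linear_combination -(a * b + c * d) * h3 - (a * a + c * c) * h1
  have e1 : (a * d - b * c) * a = (a * a + c * c) * d := by linear_combination -c * h3
  have e2 : (a * d - b * c) * c = -((a * a + c * c) * b) := by linear_combination a * h3
  rcases mul_eq_zero.1 h4 with h | h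
  · right
    exact ⟨mul_left_cancel₀ h2 (by linear_combination e1 - a * h),
      mul_left_cancel₀ h2 (by linear_combination e2 - c * h)⟩
  · left
    exact ⟨mul_left_cancel₀ h2 (by linear_combination -e1 + a * h),
      mul_left_cancel₀ h2 (by linear_combination e2 - c * h)⟩

theorem mainTheorem10 {F : Type*} [Field F] [Fintype F] (hq : Odd (Fintype.card F))
    (χ : AddChar F ℂ) (hχ : χ ≠ 1) :
    ((Fintype.card F % 4 = 1 →
        Nat.card (Matrix.specialOrthogonalGroup (Fin 2) F) = Fintype.card F - 1) ∧
      (Fintype.card F % 4 = 3 →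
        Nat.card (Matrix.specialOrthogonalGroup (Fin 2) F) = Fintype.card F + 1)) ∧
    ∃ Λ : F → F → F → ℂ,
      (∀ L₁ L₂ μ : F, Λ L₁ L₂ μ = Λ L₂ L₁ μ) ∧
      ∀ (A : GL (Fin 2) F) (L₁ L₂ μ : F),
        L₁ = colDot A.val 0 0 → L₂ = colDot A.val 1 1 → μ = colDot A.val 0 1 →
        (IsSquare (L₁ * L₂ - μ ^ 2) ∧ L₁ * L₂ - μ ^ 2 ≠ 0) ∧
        Module.End.HasEigenvector
          (Matrix.mulVecLin (digraphAdjMatrix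
            (matCayleyDigraph (Matrix.orthogonalGroup (Fin 2) F : Set _))))
          (orthoEigenvalue χ A.val) (matChar χ A.val) ∧
        orthoEigenvalue χ A.val = Λ L₁ L₂ μ ∧
        (¬ (L₁ = L₂ ∧ L₁ ≠ 0 ∧ μ = 0) →
          ‖orthoEigenvalue χ A.val‖ ≤ 4 * Real.sqrt (Fintype.card F)) ∧
        (L₁ = L₂ ∧ L₁ ≠ 0 ∧ μ = 0 →
          ∃ E : ℂ, orthoEigenvalue χ A.val =
              (Nat.card (Matrix.specialOrthogonalGroup (Fin 2) F) : ℂ) + E ∧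
            ‖E‖ ≤ 2 * Real.sqrt (Fintype.card F)) := by
  classical
  have hF : ringChar F ≠ 2 := by
    intro h
    have := FiniteField.even_card_of_char_two h
    rw [Nat.odd_iff] at hq
    omega
  have h2 : (2 : F) ≠ 0 := Ring.two_ne_zero hF
  have hcard : (Nat.card (Matrix.specialOrthogonalGroup (Fin 2) F) : ℤ) =
      Fintype.card F - quadraticChar F (-1) := by
    rw [natCard_specialOrthogonalGroup_fin_two]
    exact card_circle hF
  have hzero : circleSum χ 0 0 = (Nat.card (Matrix.specialOrthogonalGroup (Fin 2) F) : ℂ) := by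
    rw [natCard_specialOrthogonalGroup_fin_two]
    simp [circleSum]
  refine ⟨⟨fun h => ?_, fun h => ?_⟩, ?_⟩
  · have h1 : quadraticChar F (-1) = 1 :=
      (quadraticChar_one_iff_isSquare (by simp)).2 (FiniteField.isSquare_neg_one_iff.2 (by omega))
    rw [h1] at hcard
    omega
  · have h1 : quadraticChar F (-1) = -1 := by
      rw [quadraticChar_neg_one_iff_not_isSquare, FiniteField.isSquare_neg_one_iff]
      omega
    rw [h1] at hcard
    omega
  -- `Λ` takes the value `λ_A` for any `A` with the given Gram matrix, and a junk value if there
  -- is no such `A`.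
  let P : F → F → F → GL (Fin 2) F → Prop := fun L₁ L₂ μ A =>
    L₁ = colDot A.val 0 0 ∧ L₂ = colDot A.val 1 1 ∧ μ = colDot A.val 0 1
  let Λ : F → F → F → ℂ := fun L₁ L₂ μ =>
    if h : ∃ A, P L₁ L₂ μ A then orthoEigenvalue χ h.choose.val else 0
  have hgram : ∀ {A B : GL (Fin 2) F} {L₁ L₂ μ : F}, P L₁ L₂ μ A → P L₁ L₂ μ B →
      orthoEigenvalue χ A.val = orthoEigenvalue χ B.val := by
    rintro A B _ _ _ ⟨rfl, rfl, rfl⟩ ⟨h1, h2, h3⟩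
    refine orthoEigenvalue_eq_of_colDot_eq χ fun i j => ?_
    have hcomm : ∀ M : Matrix (Fin 2) (Fin 2) F, colDot M 1 0 = colDot M 0 1 := fun M =>
      dotProduct_comm _ _
    fin_cases i <;> fin_cases j
    · exact h1
    · exact h3
    · exact (hcomm _).trans (h3.trans (hcomm _).symm)
    · exact h2
  have hΛ : ∀ {A : GL (Fin 2) F} {L₁ L₂ μ : F}, P L₁ L₂ μ A →
      orthoEigenvalue χ A.val = Λ L₁ L₂ μ := by
    intro A L₁ L₂ μ hA
    have hex : ∃ A, P L₁ L₂ μ A := ⟨A, hA⟩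
    simp only [Λ, dif_pos hex]
    exact hgram hA hex.choose_spec
  have hswap : ∀ {A : GL (Fin 2) F} {L₁ L₂ μ : F}, P L₁ L₂ μ A → Λ L₁ L₂ μ = Λ L₂ L₁ μ := by
    intro A L₁ L₂ μ hA
    obtain ⟨B, hB, h1, h2, h3⟩ := exists_orthoEigenvalue_eq_colDot_swap χ A
    rw [← hΛ hA, ← hB]
    exact hΛ ⟨hA.2.1.trans h1.symm, hA.1.trans h2.symm, hA.2.2.trans h3.symm⟩
  refine ⟨Λ, fun L₁ L₂ μ => ?_, fun A L₁ L₂ μ hL₁ hL₂ hμ => ⟨?_, hasEigenvector_matChar χ A.val,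
    hΛ ⟨hL₁, hL₂, hμ⟩, fun h => ?_, ?_⟩⟩
  · by_cases h : ∃ A, P L₁ L₂ μ A
    · exact hswap h.choose_spec
    · by_cases h' : ∃ A, P L₂ L₁ μ A
      · exact (hswap h'.choose_spec).symm
      · simp only [Λ, dif_neg h, dif_neg h']
  · have hdet : L₁ * L₂ - μ ^ 2 = A.val.det * A.val.det := by
      rw [hL₁, hL₂, hμ, Matrix.det_fin_two]
      simp only [colDot, dotProduct, Fin.sum_univ_two, Matrix.col_apply]
      ring
    have hne : A.val.det ≠ 0 := ((Matrix.isUnit_iff_isUnit_det _).1 A.isUnit).ne_zero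
    rw [hdet]
    exact ⟨⟨_, rfl⟩, mul_ne_zero hne hne⟩
  · have hne : A.val.det ≠ 0 := ((Matrix.isUnit_iff_isUnit_det _).1 A.isUnit).ne_zero
    rw [Matrix.det_fin_two] at hne
    simp only [colDot, dotProduct, Fin.sum_univ_two, Matrix.col_apply] at hL₁ hL₂ hμ
    -- A zero frequency forces `A` to be a multiple of an orthogonal matrix.
    have hrot : ¬ (A.val 0 0 + A.val 1 1 = 0 ∧ A.val 0 1 - A.val 1 0 = 0) := by
      rintro ⟨h3, h4⟩
      have e1 : A.val 1 1 = -A.val 0 0 := by linear_combination h3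
      have e2 : A.val 0 1 = A.val 1 0 := by linear_combination h4
      rw [e1, e2] at hL₂ hμ hne
      refine h ⟨by rw [hL₁, hL₂]; ring, fun h5 => hne ?_, by rw [hμ]; ring⟩
      linear_combination hL₁ - h5
    have hrefl : ¬ (A.val 0 0 - A.val 1 1 = 0 ∧ A.val 0 1 + A.val 1 0 = 0) := by
      rintro ⟨h3, h4⟩
      have e1 : A.val 1 1 = A.val 0 0 := by linear_combination -h3
      have e2 : A.val 0 1 = -A.val 1 0 := by linear_combination h4
      rw [e1, e2] at hL₂ hμ hne
      refine h ⟨by rw [hL₁, hL₂]; ring, fun h5 => hne ?_, by rw [hμ]; ring⟩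
      linear_combination h5 - hL₁
    rw [orthoEigenvalue_eq_circleSum_add hF]
    refine (norm_add_le _ _).trans ?_
    have h3 := norm_circleSum_le hF hχ hrot
    have h4 := norm_circleSum_le hF hχ hrefl
    linarith
  · rintro ⟨h1, h3, h4⟩
    have hne : A.val.det ≠ 0 := ((Matrix.isUnit_iff_isUnit_det _).1 A.isUnit).ne_zero
    rw [Matrix.det_fin_two] at hne
    -- The two frequencies do not vanish together, since `A` is invertible.
    have hboth : ¬ ((A.val 0 0 + A.val 1 1 = 0 ∧ A.val 0 1 - A.val 1 0 = 0) ∧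
        (A.val 0 0 - A.val 1 1 = 0 ∧ A.val 0 1 + A.val 1 0 = 0)) := by
      rintro ⟨⟨e1, e2⟩, e3, e4⟩
      have e5 : A.val 0 0 = 0 := mul_left_cancel₀ h2 (by linear_combination e1 + e3)
      have e6 : A.val 0 1 = 0 := mul_left_cancel₀ h2 (by linear_combination e2 + e4)
      exact hne (by rw [e5, e6]; ring)
    rw [orthoEigenvalue_eq_circleSum_add hF]
    rcases eq_or_eq_neg_of_colDot_eq A (by rw [← hL₁, ← hL₂, h1]) (by rwa [← hL₁])
      (by rw [← hμ, h4]) with h | h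
    · refine ⟨_, by rw [h.1, h.2, hzero], norm_circleSum_le hF hχ fun h' => hboth ⟨h, h'⟩⟩
    · refine ⟨_, by rw [h.1, h.2, hzero, add_comm], norm_circleSum_le hF hχ fun h' => hboth ⟨h', h⟩⟩
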